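/- All logarithms are to base 2, and quantities such as $c\log n$ are rounded down. In OV indexing one preprocesses $n\ge 2$ input vectors from $\{0,1\}^{c\log n}$ (a family $S$) so as to decide, for a query $q\in\{0,1\}^{c\log n}$, whether some input vector is orthogonal to $q$. The model is a word RAM with words of $O(\log n)$ bits and unit-cost instructions; space is counted in bits. The algorithm TopLevelsQueryGraph has parameters $k\le c$, $x\le k/2$, $\tau$ and a set $W$ of $k\log n$ of the $c\log n$ coordinates. Its query graph has the vectors $\alpha\in\{0,1\}^{k\log n}$ as vertices, with an edge for every change of one $0$ into a $1$; the layer of $\alpha$ is its number of ones. For each $\alpha$ let $L_\alpha$ be the list of input vectors whose restriction to $W$ is the complement of $\alpha$, and $L'_\alpha$ the list of those whose restriction to $W$ is orthogonal to $\alpha$. The bitmap of a list records, for each possible value of the query on the remaining $(c-k)\log n$ coordinates, whether some vector of the list is orthogonal to it there. The structure stores the bitmap of $L'_\alpha$ for all $\alpha$ in the top layers $0,\dots,x\log n$, and for every other $\alpha$ with $L_\alpha\neq\emptyset$ the bitmap of $L_\alpha$ if $|L_\alpha|>n^{\tau}$ and the list $L_\alpha$ itself otherwise. A query $q$ whose restriction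 to $W$ is $\alpha$ is answered from the bitmap of $L'_\alpha$ if $\alpha$ is in a top layer; otherwise all vertices reachable from $\alpha$ are visited, and at each of them the bitmap is looked up or the list is scanned. **Theorem (TopLevelsQueryGraph).** 1. Let $0<x\le k/2$, $k\le c$, $0<\delta\le 1-k+x$, and $\tau=1-k+x-\delta$. Then, for every input and every choice of $W$, TopLevelsQueryGraph answers all queries correctly in time $\tilde O(n^{1-\delta})$, and it uses space $$\tilde O\big(n^{c-k+k\log k-x\log x-(k-x)\log(k-x)}+n^{c-x+\delta}+n\big),$$ where $\tilde O$ suppresses all factors that are $O(n^{\varepsilon})$ for every $\varepsilon>0$. The constants depend only on $c,k,x,\delta,\varepsilon$, and the word length is $b\lceil\log n\rceil$ with $b$ depending only on $c$. 2. There is a $\gamma$ with $0.29<\gamma<0.3$ and $(1+\gamma)\log(1+\gamma)-\gamma\log\gamma=1$ such that, for every $c\ge 1+\gamma$ and every $\varepsilon>0$, there are parameters $k,x,\tau$ with $|k-(1+\gamma)|<\varepsilon$, $|x-\gamma|<\varepsilon$, $0<x\le k/2$, $k\le c$, $k-x<1$ and $0\le\tau<1-k+x$ for which TopLevelsQueryGraph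 solves OV indexing, for every input and every choice of $W$, with truly sublinear query time, that is, in time $O(n^{1-\eta})$ for some $\eta>0$, using $O(n^{c-\gamma+\varepsilon})$ bits of space, with words of $b\lceil\log n\rceil$ bits, $b$ depending only on $c$. So with $k\approx 1.3$ and $x\approx 0.3$ the space is approximately $\tilde O(n^{c-0.3})$. -/

import Mathlib

/-! ### A word RAM with unit-cost instructions

Registers are named by a type `V`. Every register and memory cell holds a word, that is, a
natural number below `2 ^ w`. The memory is read-only during a query. -/

/-- The binary operations of the machine; comparisons return `0` or `1`. -/
inductive BinOp
  | add | land | lor | shl | shr | lt | eq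

/-- The value of an operation, before reduction to a word. -/
def BinOp.apply : BinOp → ℕ → ℕ → ℕ
  | .add, a, b => a + b
  | .land, a, b => a &&& b
  | .lor, a, b => a ||| b
  | .shl, a, b => a <<< b
  | .shr, a, b => a >>> b
  | .lt, a, b => if a < b then 1 else 0
  | .eq, a, b => if a = b then 1 else 0

/-- Expressions over constants, registers and memory cells. -/
inductive Expr (V : Type)
  | const (a : ℕ)
  | reg (i : V)
  | load (e : Expr V)
  | bin (o : BinOp) (e f : Expr V)

/-- The value of an expression on a machine with `w`-bit words. A load from an address outside
the memory returns `0`. -/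
def Expr.eval {V : Type} (w : ℕ) (mem : List ℕ) (s : V → ℕ) : Expr V → ℕ
  | .const a => a % 2 ^ w
  | .reg i => s i % 2 ^ w
  | .load e => mem.getD (e.eval w mem s) 0 % 2 ^ w
  | .bin o e f => o.apply (e.eval w mem s) (f.eval w mem s) % 2 ^ w

/-- The number of steps that the evaluation of an expression takes: every constant, register
access, memory access and operation counts as one step. -/
def Expr.cost {V : Type} : Expr V → ℕ
  | .const _ => 1
  | .reg _ => 1
  | .load e => e.cost + 1
  | .bin _ e f => e.cost + f.cost + 1

/-- Programs. A test succeeds when its value is not `0`. -/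
inductive Prog (V : Type)
  | skip
  | assign (i : V) (e : Expr V)
  | seq (p q : Prog V)
  | ite (e : Expr V) (p q : Prog V)
  | loop (e : Expr V) (p : Prog V)

/-- Sequential composition of a list of programs. -/
def Prog.block {V : Type} : List (Prog V) → Prog V
  | [] => .skip
  | p :: ps => .seq p (Prog.block ps)

/-- `Exec w mem p s s' t`: on a machine with `w`-bit words and memory content `mem`, the program
`p` started with register contents `s` halts with register contents `s'` after exactly `t`
steps. -/
inductive Exec {V : Type} [DecidableEq V] (w : ℕ) (mem : List ℕ) :
    Prog V → (V → ℕ) → (V → ℕ) → ℕ → Prop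
  | skip (s : V → ℕ) : Exec w mem .skip s s 1
  | assign (i : V) (e : Expr V) (s : V → ℕ) :
      Exec w mem (.assign i e) s (Function.update s i (e.eval w mem s)) (e.cost + 1)
  | seq {p q : Prog V} {s s₁ s₂ : V → ℕ} {t₁ t₂ : ℕ} :
      Exec w mem p s s₁ t₁ → Exec w mem q s₁ s₂ t₂ → Exec w mem (.seq p q) s s₂ (t₁ + t₂)
  | ite_true {e : Expr V} {p q : Prog V} {s s₁ : V → ℕ} {t : ℕ} :
      e.eval w mem s ≠ 0 → Exec w mem p s s₁ t →
        Exec w mem (.ite e p q) s s₁ (e.cost + 1 + t)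
  | ite_false {e : Expr V} {p q : Prog V} {s s₁ : V → ℕ} {t : ℕ} :
      e.eval w mem s = 0 → Exec w mem q s s₁ t →
        Exec w mem (.ite e p q) s s₁ (e.cost + 1 + t)
  | loop_done {e : Expr V} {p : Prog V} {s : V → ℕ} :
      e.eval w mem s = 0 → Exec w mem (.loop e p) s s (e.cost + 1)
  | loop_step {e : Expr V} {p : Prog V} {s s₁ s₂ : V → ℕ} {t₁ t₂ : ℕ} :
      e.eval w mem s ≠ 0 → Exec w mem p s s₁ t₁ → Exec w mem (.loop e p) s₁ s₂ t₂ →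
        Exec w mem (.loop e p) s s₂ (e.cost + 1 + t₁ + t₂)

/-! ### The data structure

A boolean vector `v` of length `d` is coded by the number `Nat.ofBits v`, whose `i`-th binary digit
is `v i`. -/

/-- Orthogonality of boolean vectors: their inner product over the integers is zero. -/
def OrthVec {d : ℕ} (u v : Fin d → Bool) : Prop :=
  (fun i => ((u i).toNat : ℤ)) ⬝ᵥ (fun i => ((v i).toNat : ℤ)) = 0

/-- The elements of a set of coordinates, in increasing order. -/
def positions {d : ℕ} (W : Finset (Fin d)) : List ℕ :=
  (W.sort (· ≤ ·)).map (fun i => (i : ℕ))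

/-- The restriction of the vector with code `v` to the listed coordinates, as a code. -/
def restrict (P : List ℕ) (v : ℕ) : ℕ :=
  Nat.ofBits (fun j : Fin P.length => v.testBit P[j])

/-- The layer of the vertex `α` of the query graph on `K` coordinates: its number of ones.

The vertices of the query graph are the boolean vectors of length `K` (coded by the numbers below
`2 ^ K`), its edges turn one `0` into a `1`; hence the vertices reachable from `α` are those
whose set of ones contains the set of ones of `α`. -/
def layer (K α : ℕ) : ℕ :=
  ((Finset.range K).filter (fun j => α.testBit j = true)).card

section Structure

variable {d n : ℕ} (S : Fin n → Fin d → Bool) (W : Finset (Fin d)) (X T : ℕ)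

/-- The codes of the input vectors. -/
def inputCodes : List ℕ := List.ofFn (fun i => Nat.ofBits (S i))

/-- The list `L α`: the input vectors whose restriction to `W` is the complement of `α`. -/
def vertexList (α : ℕ) : List ℕ :=
  (inputCodes S).filter (fun u => restrict (positions W) u ^^^ α = 2 ^ W.card - 1)

/-- The list `L' α`: all input vectors whose restriction to `W` is orthogonal to `α`. -/
def orthList (α : ℕ) : List ℕ :=
  (inputCodes S).filter (fun u => restrict (positions W) u &&& α = 0)

/-- The bitmap of a list of input vectors: for each of the possible values `r` of a query vector on
the coordinates outside `W`, whether some vector of the list is orthogonal to `r` there. -/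
def bitmap (L : List ℕ) : List ℕ :=
  (List.range (2 ^ (Wᶜ).card)).map fun r =>
    if ∃ u ∈ L, restrict (positions Wᶜ) u &&& r = 0 then 1 else 0

/-- Whether the vertex `α` carries a bitmap: it lies in the top layers `0, …, X`, or its list `L α`
has more than `T` elements. -/
def hasBitmap (α : ℕ) : Prop := layer W.card α ≤ X ∨ T < (vertexList S W α).length

instance (α : ℕ) : Decidable (hasBitmap S W X T α) :=
  inferInstanceAs (Decidable (_ ∨ _))

/-- What is stored at the vertex `α`: the bitmap of `L' α` in the top layers; in the other layers,
the bitmap of `L α` if that list is long, and the list `L α` itself otherwise. -/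
def content (α : ℕ) : List ℕ :=
  if layer W.card α ≤ X then bitmap W (orthList S W α)
  else if T < (vertexList S W α).length then bitmap W (vertexList S W α)
  else vertexList S W α

/-- The stored vertices, in increasing order of their codes: those in the top layers, and those
whose list is not empty. -/
def storedVertices : List ℕ :=
  (List.range (2 ^ W.card)).filter fun α => layer W.card α ≤ X ∨ vertexList S W α ≠ []

/-- The directory of the given vertices, for contents that are stored consecutively from address
`p` on: for each vertex its code, `1` if it carries a bitmap and `0` otherwise, and the address
and the length of its content. -/
def directory : List ℕ → ℕ → List ℕ
  | [], _ => []
  | α :: l, p =>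
      [α, if hasBitmap S W X T α then 1 else 0, p, (content S W X T α).length] ++
        directory l (p + (content S W X T α).length)

/-- The memory content that the preprocessing phase of TopLevelsQueryGraph produces. -/
def topLevelsMemory : List ℕ :=
  [W.card, (Wᶜ).card, X, (storedVertices S W X).length] ++
    positions W ++ positions Wᶜ ++
    directory S W X T (storedVertices S W X)
      (4 + d + 4 * (storedVertices S W X).length) ++
    (storedVertices S W X).flatMap (content S W X T)

end Structure

/-! ### The query program

The program is fixed: it depends neither on the input nor on any parameter. -/

/-- The registers of the query program. -/
inductive QReg
  | q | a | r | cnt | j | bit | b | lo | hi | mid | ent | ptr | fin | ans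
  deriving DecidableEq

namespace QueryProgram

open Expr Prog BinOp

/-- The number of coordinates in `W`. -/
def numW : Expr QReg := load (const 0)

/-- The number of coordinates outside `W`. -/
def numRest : Expr QReg := load (const 1)

/-- The last of the top layers. -/
def topLayer : Expr QReg := load (const 2)

/-- The number of entries of the directory. -/
def numEntries : Expr QReg := load (const 3)

/-- The address of the directory entry with index `e`. -/
def entry (e : Expr QReg) : Expr QReg :=
  bin add (bin add (bin add (const 4) numW) numRest) (bin shl e (const 2))

/-- `a` := restriction of the query to `W`, `cnt` := its number of ones. -/
def readW : Prog QReg :=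
  block [
    assign .j (const 0),
    loop (bin lt (reg .j) numW) (block [
      assign .bit (bin land
        (bin shr (reg .q) (load (bin add (const 4) (reg .j)))) (const 1)),
      assign .a (bin lor (reg .a) (bin shl (reg .bit) (reg .j))),
      assign .cnt (bin add (reg .cnt) (reg .bit)),
      assign .j (bin add (reg .j) (const 1))])]

/-- `r` := restriction of the query to the coordinates outside `W`. -/
def readRest : Prog QReg :=
  block [
    assign .j (const 0),
    loop (bin lt (reg .j) numRest) (block [
      assign .bit (bin land
        (bin shr (reg .q) (load (bin add (bin add (const 4) numW) (reg .j)))) (const 1)),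
      assign .r (bin lor (reg .r) (bin shl (reg .bit) (reg .j))),
      assign .j (bin add (reg .j) (const 1))])]

/-- Binary search: `lo` := index of the first directory entry whose vertex is at least `b`. -/
def search : Prog QReg :=
  block [
    assign .lo (const 0),
    assign .hi numEntries,
    loop (bin lt (reg .lo) (reg .hi)) (block [
      assign .mid (bin shr (bin add (reg .lo) (reg .hi)) (const 1)),
      ite (bin lt (load (entry (reg .mid))) (reg .b))
        (assign .lo (bin add (reg .mid) (const 1)))
        (assign .hi (reg .mid))])]

/-- Examine the content of the vertex at address `ent` of the directory: look up one bit of the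
bitmap, or go through the list. -/
def examine : Prog QReg :=
  block [
    assign .ptr (load (bin add (reg .ent) (const 2))),
    ite (load (bin add (reg .ent) (const 1)))
      (assign .ans (bin lor (reg .ans) (load (bin add (reg .ptr) (reg .r)))))
      (block [
        assign .fin (bin add (reg .ptr) (load (bin add (reg .ent) (const 3)))),
        loop (bin lt (reg .ptr) (reg .fin)) (block [
          assign .ans (bin lor (reg .ans)
            (bin eq (bin land (load (reg .ptr)) (reg .q)) (const 0))),
          assign .ptr (bin add (reg .ptr) (const 1))])])]

/-- Visit the vertex `b`: find it in the directory and examine its content. -/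
def visit : Prog QReg :=
  block [
    search,
    ite (bin lt (reg .lo) numEntries)
      (block [
        assign .ent (entry (reg .lo)),
        ite (bin eq (load (reg .ent)) (reg .b)) examine skip])
      skip]

/-- Visit the vertex `a` only, if it lies in the top layers; otherwise visit all vertices that are
reachable from `a`, in increasing order of their codes (the next one after `b` is `(b + 1) ||| a`). -/
def traverse : Prog QReg :=
  block [
    assign .b (reg .a),
    loop (bin lt (reg .b) (bin shl (const 1) numW)) (block [
      visit,
      ite (bin lt topLayer (reg .cnt))
        (assign .b (bin lor (bin add (reg .b) (const 1)) (reg .a)))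
        (assign .b (bin shl (const 1) numW))])]

end QueryProgram

/-- The query algorithm of TopLevelsQueryGraph. The query vector is given in the register `q`, and
the answer, `1` or `0`, is left in the register `ans`. -/
def topLevelsQuery : Prog QReg :=
  .block [QueryProgram.readW, QueryProgram.readRest, QueryProgram.traverse]

/-- Initial register contents: the code of the query vector in `q`, and `0` elsewhere. -/
def initRegs {d : ℕ} (v : Fin d → Bool) : QReg → ℕ :=
  Function.update (fun _ => 0) QReg.q (Nat.ofBits v)

/-! ### Complexity -/

/-- `c log n`, rounded down; logarithms are to base `2`. -/
noncomputable def logMul (c : ℝ) (n : ℕ) : ℕ := ⌊c * Real.logb 2 n⌋₊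

/-- The word length `b ⌈log n⌉`. -/
def wordLength (b n : ℕ) : ℕ := b * Nat.clog 2 n

open Classical in
/-- TopLevelsQueryGraph with `|W| = k log n`, with bitmaps in the top layers `0, …, x log n` and
for lists with more than `n ^ τ` elements, solves OV indexing for all families of `n ≥ 2` boolean
vectors of length `c log n` and for every choice of `W`, on a machine with words of
`b ⌈log n⌉` bits, such that every query takes at most `time n` steps and the data structure occupies
at most `space n` bits. -/
def TopLevelsSolvesOV (c k x τ : ℝ) (b : ℕ) (time space : ℕ → ℝ) : Prop :=
  ∀ n : ℕ, 2 ≤ n → ∀ (S : Fin n → Fin (logMul c n) → Bool) (W : Finset (Fin (logMul c n))),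
    W.card = logMul k n →
      (∀ a ∈ topLevelsMemory S W (logMul x n) ⌊(n : ℝ) ^ τ⌋₊, a < 2 ^ wordLength b n) ∧
      ((topLevelsMemory S W (logMul x n) ⌊(n : ℝ) ^ τ⌋₊).length * wordLength b n : ℝ)
        ≤ space n ∧
      ∀ v : Fin (logMul c n) → Bool, ∃ (s : QReg → ℕ) (t : ℕ),
        Exec (wordLength b n) (topLevelsMemory S W (logMul x n) ⌊(n : ℝ) ^ τ⌋₊)
          topLevelsQuery (initRegs v) s t ∧
        (t : ℝ) ≤ time n ∧
        s QReg.ans = if ∃ i, OrthVec (S i) v then 1 else 0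

/-- The exponent in the estimate of the binomial coefficient with entries `k log n` and `x log n`
by a power of `n`. -/
noncomputable def binomExponent (k x : ℝ) : ℝ :=
  k * Real.logb 2 k - x * Real.logb 2 x - (k - x) * Real.logb 2 (k - x)

/-! Correctness. A vector `u` is orthogonal to `q` iff it is so on `W` and off `W`. If `x` and `α`
are the restrictions of `u` and `q` to `W`, then `x` and `α` are orthogonal iff the complement of
`x` contains the ones of `α`, that is, iff it is reachable from `α` (`and_eq_zero_of_xor`,
`exists_complement`). Hence `L' α` is the disjoint union of the lists `L c` over the reachable `c`.
At a reachable vertex orthogonality on `W` is automatic, so a bitmap that only looks outside `W`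
suffices (`hit_iff_of_reachable`); `answer_iff` puts this together.

Time. The vertices reachable from `a` are the `c < 2 ^ K` with `c &&& a = a`; they are enumerated in
order by `b ↦ (b + 1) ||| a` (`succ_or_le`), and there are `2 ^ (K - layer K a)` of them at most
(`card_supersets_le`), hence at most `n ^ (k - x)` below the top layers. A visit is a binary search
followed by one lookup or a scan of at most `n ^ τ` vectors, so the total is `n ^ (k - x + τ) = n ^
(1 - δ)` up to logarithms. `Layout` and `Decides` isolate what the program needs to know about the
memory, and `Layout.runs_query` is proved from them alone.

Space. The lists `L α` partition the input, so at most `n ^ (1 - τ)` of them have more than `n ^ τ`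
elements (`longCount_mul_le`). The top vertices are counted by a Chernoff bound: `∑ y ^ layer = (1 +
y) ^ K`, evaluated at `y = x / (k - x)`, gives the entropy exponent (`topCount_logMul_le`). Each
bitmap has at most `2 * n ^ (c - k)` cells.

Second part. With `x = γ` and `k = 1 + γ` the space exponent would be `c - γ`, but the time exponent
would be `1`. Moving `k` slightly below `1 + γ` makes the time truly sublinear, and by continuity
costs little space. The number `γ` comes from the intermediate value theorem. -/

/-! ### Evaluation of expressions without overflow -/

namespace Expr

variable {V : Type} {w : ℕ} {mem : List ℕ} {s : V → ℕ} {e f : Expr V} {a b : ℕ}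

theorem eval_lt_two_pow (e : Expr V) : e.eval w mem s < 2 ^ w := by
  cases e <;> exact Nat.mod_lt _ (by positivity)

theorem eval_const (h : a < 2 ^ w) : (const a : Expr V).eval w mem s = a :=
  Nat.mod_eq_of_lt h

theorem eval_reg {i : V} (h : s i = a) (ha : a < 2 ^ w) : (reg i).eval w mem s = a := by
  subst h; exact Nat.mod_eq_of_lt ha

theorem eval_load (he : e.eval w mem s = a) (hm : mem.getD a 0 = b) (hb : b < 2 ^ w) :
    (load e).eval w mem s = b := by
  subst hm; subst he; exact Nat.mod_eq_of_lt hb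

theorem eval_add (he : e.eval w mem s = a) (hf : f.eval w mem s = b) (h : a + b < 2 ^ w) :
    (bin .add e f).eval w mem s = a + b := by
  subst he; subst hf; exact Nat.mod_eq_of_lt h

theorem eval_land (he : e.eval w mem s = a) (hf : f.eval w mem s = b) :
    (bin .land e f).eval w mem s = a &&& b := by
  subst he; subst hf
  exact Nat.mod_eq_of_lt (Nat.and_lt_two_pow _ f.eval_lt_two_pow)

theorem eval_lor (he : e.eval w mem s = a) (hf : f.eval w mem s = b) :
    (bin .lor e f).eval w mem s = a ||| b := by
  subst he; subst hf
  exact Nat.mod_eq_of_lt (Nat.or_lt_two_pow e.eval_lt_two_pow f.eval_lt_two_pow)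

theorem eval_shl (he : e.eval w mem s = a) (hf : f.eval w mem s = b) (h : a <<< b < 2 ^ w) :
    (bin .shl e f).eval w mem s = a <<< b := by
  subst he; subst hf; exact Nat.mod_eq_of_lt h

theorem eval_shr (he : e.eval w mem s = a) (hf : f.eval w mem s = b) :
    (bin .shr e f).eval w mem s = a >>> b := by
  subst he; subst hf
  exact Nat.mod_eq_of_lt (lt_of_le_of_lt (Nat.shiftRight_le _ _) e.eval_lt_two_pow)

theorem eval_eq (hw : 0 < w) (he : e.eval w mem s = a) (hf : f.eval w mem s = b) :
    (bin .eq e f).eval w mem s = if a = b then 1 else 0 := by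
  subst he; subst hf
  refine Nat.mod_eq_of_lt ?_
  have : 1 < 2 ^ w := Nat.one_lt_two_pow hw.ne'
  simp only [BinOp.apply]; split <;> omega

theorem eval_lt (hw : 0 < w) (he : e.eval w mem s = a) (hf : f.eval w mem s = b) :
    (bin .lt e f).eval w mem s = if a < b then 1 else 0 := by
  subst he; subst hf
  refine Nat.mod_eq_of_lt ?_
  have : 1 < 2 ^ w := Nat.one_lt_two_pow hw.ne'
  simp only [BinOp.apply]; split <;> omega

theorem eval_lt_ne_zero (hw : 0 < w) (he : e.eval w mem s = a) (hf : f.eval w mem s = b) :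
    (bin .lt e f).eval w mem s ≠ 0 ↔ a < b := by
  rw [eval_lt hw he hf]; split <;> simp_all

theorem eval_lt_eq_zero (hw : 0 < w) (he : e.eval w mem s = a) (hf : f.eval w mem s = b) :
    (bin .lt e f).eval w mem s = 0 ↔ b ≤ a := by
  rw [eval_lt hw he hf]; split <;> simp_all

end Expr

/-! ### A program logic with time bounds -/

/-- The program `p`, started with registers `s`, halts within `B` steps with registers that satisfy
`Q`. -/
def Runs {V : Type} [DecidableEq V] (w : ℕ) (mem : List ℕ) (p : Prog V) (s : V → ℕ) (B : ℕ)
    (Q : (V → ℕ) → Prop) : Prop :=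
  ∃ s' t, Exec w mem p s s' t ∧ t ≤ B ∧ Q s'

namespace Runs

variable {V : Type} [DecidableEq V] {w : ℕ} {mem : List ℕ} {s : V → ℕ} {e : Expr V}
  {p q : Prog V} {ps : List (Prog V)} {B B₁ B₂ v : ℕ} {Q Q' : (V → ℕ) → Prop} {i : V}

theorem mono (h : Runs w mem p s B₁ Q) (hB : B₁ ≤ B₂) (hQ : ∀ s', Q s' → Q' s') :
    Runs w mem p s B₂ Q' := by
  obtain ⟨s', t, hx, ht, hq⟩ := h
  exact ⟨s', t, hx, ht.trans hB, hQ _ hq⟩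

theorem mono_time (h : Runs w mem p s B₁ Q) (hB : B₁ ≤ B₂) : Runs w mem p s B₂ Q :=
  h.mono hB fun _ => id

theorem skip (hQ : Q s) : Runs w mem .skip s 1 Q := ⟨_, _, .skip s, le_rfl, hQ⟩

theorem assign (he : e.eval w mem s = v) (hQ : Q (Function.update s i v)) :
    Runs w mem (.assign i e) s (e.cost + 1) Q := by
  subst he; exact ⟨_, _, .assign i e s, le_rfl, hQ⟩

theorem block_nil (hQ : Q s) : Runs w mem (.block []) s 1 Q := skip hQ

/-- The run of the remaining block is the postcondition of the first program; nested in this way,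
straight-line code is verified by one term, and the time bounds add up. -/
theorem block_cons (h : Runs w mem p s B₁ fun s₁ => Runs w mem (.block ps) s₁ B₂ Q) :
    Runs w mem (.block (p :: ps)) s (B₁ + B₂) Q := by
  obtain ⟨s₁, t₁, h₁, ht₁, s₂, t₂, h₂, ht₂, hQ⟩ := h
  exact ⟨_, _, .seq h₁ h₂, by omega, hQ⟩

theorem assign_cons (he : e.eval w mem s = v)
    (h : Runs w mem (.block ps) (Function.update s i v) B Q) :
    Runs w mem (.block (.assign i e :: ps)) s (e.cost + 1 + B) Q :=
  block_cons (assign he h)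

theorem ite (h₁ : e.eval w mem s ≠ 0 → Runs w mem p s B Q)
    (h₂ : e.eval w mem s = 0 → Runs w mem q s B Q) :
    Runs w mem (.ite e p q) s (e.cost + 1 + B) Q := by
  by_cases h : e.eval w mem s = 0
  · obtain ⟨s', t, hx, ht, hq⟩ := h₂ h
    exact ⟨_, _, .ite_false h hx, by omega, hq⟩
  · obtain ⟨s', t, hx, ht, hq⟩ := h₁ h
    exact ⟨_, _, .ite_true h hx, by omega, hq⟩

/-- A loop with invariant `I m`, where `m` bounds the number of the remaining iterations. -/
theorem loop (I : ℕ → (V → ℕ) → Prop)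
    (hI : ∀ m s, I m s → e.eval w mem s ≠ 0 → ∃ m', m = m' + 1 ∧ Runs w mem p s B (I m'))
    (m : ℕ) {s : V → ℕ} (hs : I m s) :
    Runs w mem (.loop e p) s (m * (B + e.cost + 1) + e.cost + 1)
      fun s' => (∃ m', I m' s') ∧ e.eval w mem s' = 0 := by
  induction m generalizing s with
  | zero =>
    by_cases h : e.eval w mem s = 0
    · exact ⟨_, _, .loop_done h, by omega, ⟨_, hs⟩, h⟩
    · obtain ⟨m', hm, -⟩ := hI _ _ hs h
      omega
  | succ m ih =>
    by_cases h : e.eval w mem s = 0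
    · exact ⟨_, _, .loop_done h, by omega, ⟨_, hs⟩, h⟩
    · obtain ⟨m', hm, s₁, t₁, hx₁, ht₁, hs₁⟩ := hI _ _ hs h
      obtain rfl : m = m' := by omega
      obtain ⟨s₂, t₂, hx₂, ht₂, hs₂⟩ := ih hs₁
      refine ⟨_, _, .loop_step h hx₁ hx₂, ?_, hs₂⟩
      rw [add_mul]; omega

end Runs

/-! ### Memory layout, register contents and binary digits -/

/-- The memory holds the two lists of positions `P` and `R`, the number `X` of the last top layer,
and a directory of the vertices in `V`; `bm α` says that the content `cont α` of `α` is a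
bitmap. -/
structure Layout (w : ℕ) (mem P R : List ℕ) (X : ℕ) (V : List ℕ) (bm : ℕ → Prop)
    (cont : ℕ → List ℕ) : Prop where
  lt_word : ∀ a ∈ mem, a < 2 ^ w
  length_lt : mem.length < 2 ^ w
  pow_le : 2 ^ (P.length + 1) ≤ 2 ^ w
  pow_le' : 2 ^ (R.length + 1) ≤ 2 ^ w
  numW : mem.getD 0 0 = P.length
  numRest : mem.getD 1 0 = R.length
  topLayer : mem.getD 2 0 = X
  numEntries : mem.getD 3 0 = V.length
  pos : ∀ j (h : j < P.length), mem.getD (4 + j) 0 = P[j]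
  pos' : ∀ j (h : j < R.length), mem.getD (4 + P.length + j) 0 = R[j]
  directory_le : 4 + P.length + R.length + 4 * V.length ≤ mem.length
  vertex : ∀ i (h : i < V.length), mem.getD (4 + P.length + R.length + 4 * i) 0 = V[i]
  flag_one : ∀ i (h : i < V.length), bm V[i] →
    mem.getD (4 + P.length + R.length + 4 * i + 1) 0 = 1
  flag_zero : ∀ i (h : i < V.length), ¬ bm V[i] →
    mem.getD (4 + P.length + R.length + 4 * i + 1) 0 = 0
  content_length : ∀ i (h : i < V.length),
    mem.getD (4 + P.length + R.length + 4 * i + 3) 0 = (cont V[i]).length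
  content_le : ∀ i (h : i < V.length),
    mem.getD (4 + P.length + R.length + 4 * i + 2) 0 + (cont V[i]).length ≤ mem.length
  content : ∀ i (h : i < V.length) j (hj : j < (cont V[i]).length),
    mem.getD (mem.getD (4 + P.length + R.length + 4 * i + 2) 0 + j) 0 = (cont V[i])[j]
  sorted : V.Pairwise (· < ·)
  vertex_lt : ∀ α ∈ V, α < 2 ^ P.length

/-- The contents of the registers that the search for a vertex does not change. -/
structure Regs (q a r cnt b ans : ℕ) (s : QReg → ℕ) : Prop where
  q : s .q = q
  a : s .a = a
  r : s .r = r
  cnt : s .cnt = cnt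
  b : s .b = b
  ans : s .ans = ans

section

variable {q a r cnt b ans v : ℕ} {s : QReg → ℕ}

theorem Regs.update {i : QReg} (h : Regs q a r cnt b ans s)
    (hi : i ≠ .q ∧ i ≠ .a ∧ i ≠ .r ∧ i ≠ .cnt ∧ i ≠ .b ∧ i ≠ .ans) :
    Regs q a r cnt b ans (Function.update s i v) := by
  obtain ⟨h1, h2, h3, h4, h5, h6⟩ := hi
  constructor <;> rw [Function.update_of_ne (Ne.symm ‹_›)]
  exacts [h.q, h.a, h.r, h.cnt, h.b, h.ans]

theorem Regs.update_ans (h : Regs q a r cnt b ans s) :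
    Regs q a r cnt b v (Function.update s .ans v) := by
  constructor <;> simp [h.q, h.a, h.r, h.cnt, h.b]

theorem Regs.update_b (h : Regs q a r cnt b ans s) :
    Regs q a r cnt v ans (Function.update s .b v) := by
  constructor <;> simp [h.q, h.a, h.r, h.cnt, h.ans]

theorem testBit_toNat_eq (x p : ℕ) : (x >>> p) &&& 1 = (x.testBit p).toNat := by
  rw [Nat.testBit_eq_decide_div_mod_eq, Nat.and_one_is_mod, Nat.shiftRight_eq_div_pow]
  rcases Nat.mod_two_eq_zero_or_one (x / 2 ^ p) with h | h <;> simp [h]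

/-- One round of assembling a number from its digits: the loop invariant of the reading phase is
that the register holds `x % 2 ^ j`. -/
theorem mod_two_pow_or_testBit (x j : ℕ) :
    (x % 2 ^ j) ||| ((x.testBit j).toNat <<< j) = x % 2 ^ (j + 1) := by
  apply Nat.eq_of_testBit_eq
  intro i
  simp only [Nat.testBit_or, Nat.testBit_mod_two_pow, Nat.testBit_shiftLeft]
  rcases lt_trichotomy i j with h | h | h
  · simp [h, Nat.lt_succ_of_lt h, not_le.2 h]
  · subst h; cases hx : x.testBit i <;> simp
  · have : Nat.testBit 1 (i - j) = false := by
      rw [Bool.eq_false_iff, Ne, Nat.testBit_one_eq_true_iff_self_eq_zero]; omega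
    cases x.testBit j <;> simp [not_lt.2 h.le, show ¬ i < j + 1 by omega, this]

theorem layer_succ (j x : ℕ) : layer (j + 1) x = layer j x + (x.testBit j).toNat := by
  unfold layer
  rw [Finset.range_add_one, Finset.filter_insert]
  split <;> simp_all

theorem layer_le (j x : ℕ) : layer j x ≤ j :=
  (Finset.card_filter_le _ _).trans_eq (Finset.card_range j)

theorem restrict_lt (P : List ℕ) (v : ℕ) : restrict P v < 2 ^ P.length :=
  Nat.ofBits_lt_two_pow _

theorem testBit_restrict {P : List ℕ} {v j : ℕ} (h : j < P.length) :
    (restrict P v).testBit j = v.testBit P[j] := by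
  simp [restrict, h]

theorem testBit_restrict_ge {P : List ℕ} {v j : ℕ} (h : P.length ≤ j) :
    (restrict P v).testBit j = false := by
  simp [restrict, h]

/-- After `b`, the next number whose binary digits include those of `a` is `(b + 1) ||| a`. -/
theorem succ_or_le {a : ℕ} : ∀ {b c : ℕ}, b &&& a = a → c &&& a = a → b < c →
    (b + 1) ||| a ≤ c := by
  induction a using Nat.strong_induction_on with
  | _ a ih =>
  intro b c hb hc hbc
  rcases Nat.eq_zero_or_pos a with rfl | ha
  · simpa using hbc
  have e1 : b / 2 &&& a / 2 = a / 2 := by rw [← Nat.and_div_two, hb]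
  have e2 : c / 2 &&& a / 2 = a / 2 := by rw [← Nat.and_div_two, hc]
  have m1 : a % 2 ≤ b % 2 := by
    have := congrArg (· % 2) hb
    simp only [← Nat.and_one_is_mod] at this ⊢
    rw [← this, Nat.and_right_comm]; exact Nat.and_le_left
  have m2 : a % 2 ≤ c % 2 := by
    have := congrArg (· % 2) hc
    simp only [← Nat.and_one_is_mod] at this ⊢
    rw [← this, Nat.and_right_comm]; exact Nat.and_le_left
  have key : ((b + 1) ||| a) / 2 = (b + 1) / 2 ||| a / 2 := Nat.or_div_two
  have keym : ((b + 1) ||| a) % 2 = ((b + 1) % 2 ||| a % 2) := by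
    have := @Nat.or_mod_two_pow (b + 1) a 1
    simpa using this
  -- If `b` is even, then so is `a`, and the next number is just `b + 1`. If `b` is odd, adding `1`
  -- carries into the halves, to which the induction hypothesis applies; the last digit then falls
  -- back to that of `a`, which is at most that of `c`.
  rcases Nat.mod_two_eq_zero_or_one b with hb2 | hb2
  · have ha2 : a % 2 = 0 := by omega
    have h1 : (b + 1) / 2 = b / 2 := by omega
    have h2 : b / 2 ||| a / 2 = b / 2 := by
      rw [← e1, Nat.or_comm]; exact Nat.eq_of_testBit_eq fun i => by simp; grind
    rw [h1, h2] at key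
    rw [ha2] at keym
    have h3 : (b + 1) % 2 = 1 := by omega
    rw [h3] at keym
    simp at keym
    omega
  · have h1 : (b + 1) / 2 = b / 2 + 1 := by omega
    have h2 := ih (a / 2) (by omega) e1 e2 (show b / 2 < c / 2 by omega)
    rw [h1] at key
    have h3 : (b + 1) % 2 = 0 := by omega
    rw [h3, Nat.zero_or] at keym
    omega

/-- A superset of `a` is determined by its additional ones, which form a subset of the `K - layer K
a` zeros of `a`. -/
theorem card_supersets_le (K a : ℕ) :
    ((Finset.range (2 ^ K)).filter fun c => c &&& a = a).card ≤ 2 ^ (K - layer K a) := by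
  have h1 : ((Finset.range K).filter fun j => ¬ a.testBit j = true).card = K - layer K a := by
    have := Finset.card_filter_add_card_filter_not (s := Finset.range K)
      (fun j => a.testBit j = true)
    rw [Finset.card_range] at this
    unfold layer; omega
  rw [← h1, ← Finset.card_powerset]
  refine Finset.card_le_card_of_injOn
    (fun c => (Finset.range K).filter fun j => c.testBit j = true ∧ ¬ a.testBit j = true) ?_ ?_
  · intro c _
    simp only [Finset.coe_powerset, Set.mem_preimage, Set.mem_powerset_iff, Finset.coe_subset]
    intro j; simp; tauto
  · intro c hc c' hc' h
    simp only [Finset.coe_filter, Finset.mem_range, Set.mem_ofPred_eq] at hc hc'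
    apply Nat.eq_of_testBit_eq
    intro j
    rcases lt_or_ge j K with hj | hj
    · have h2 := Finset.ext_iff.1 h j
      have h3 := congrArg (·.testBit j) hc.2
      have h4 := congrArg (·.testBit j) hc'.2
      simp only [Nat.testBit_and, Finset.mem_filter, Finset.mem_range] at h2 h3 h4
      cases hA : a.testBit j <;> cases hB : c.testBit j <;> cases hC : c'.testBit j <;> simp_all
    · rw [Nat.testBit_lt_two_pow (hc.1.trans_le (Nat.pow_le_pow_right (by norm_num) hj)),
        Nat.testBit_lt_two_pow (hc'.1.trans_le (Nat.pow_le_pow_right (by norm_num) hj))]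

/-- From a vertex below the top layers one reaches only such vertices, so the traversal never meets
a bitmap of a list `L'`. -/
theorem layer_le_layer {K a c : ℕ} (h : c &&& a = a) : layer K a ≤ layer K c := by
  refine Finset.card_le_card fun j => ?_
  have h3 := congrArg (·.testBit j) h
  simp only [Nat.testBit_and, Finset.mem_filter, Finset.mem_range] at h3 ⊢
  grind

end

/-! ### Reading the query and searching the directory -/

namespace Layout

open Expr

variable {w : ℕ} {mem P R : List ℕ} {X : ℕ} {V : List ℕ} {bm : ℕ → Prop} {cont : ℕ → List ℕ}
  {s : QReg → ℕ} {q a r cnt b ans : ℕ}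

theorem getD_lt (L : Layout w mem P R X V bm cont) (i : ℕ) : mem.getD i 0 < 2 ^ w := by
  rcases lt_or_ge i mem.length with h | h
  · rw [List.getD_eq_getElem _ _ h]; exact L.lt_word _ (List.getElem_mem h)
  · rw [List.getD_eq_default _ _ h]; positivity

theorem eval_load (L : Layout w mem P R X V bm cont) {e : Expr QReg} {p v : ℕ}
    (he : e.eval w mem s = p) (hv : mem.getD p 0 = v) : (load e).eval w mem s = v :=
  Expr.eval_load he hv (hv ▸ L.getD_lt p)

theorem four_le (L : Layout w mem P R X V bm cont) : 4 ≤ mem.length :=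
  le_trans (by omega) L.directory_le

/-- The header alone has four cells and the memory length is below `2 ^ w`; this covers every
constant that the program uses. -/
theorem const_lt (L : Layout w mem P R X V bm cont) {i : ℕ} (h : i < 5) : i < 2 ^ w := by
  have := L.four_le; have := L.length_lt; omega

theorem word_pos (L : Layout w mem P R X V bm cont) : 0 < w := by
  rcases Nat.eq_zero_or_pos w with rfl | h
  · simpa using L.const_lt (i := 1) (by norm_num)
  · exact h

theorem eval_const (L : Layout w mem P R X V bm cont) {i : ℕ} (h : i < 5) :
    (const i : Expr QReg).eval w mem s = i := Expr.eval_const (L.const_lt h)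

theorem eval_numW (L : Layout w mem P R X V bm cont) :
    QueryProgram.numW.eval w mem s = P.length := L.eval_load (L.eval_const (by norm_num)) L.numW

theorem eval_numRest (L : Layout w mem P R X V bm cont) :
    QueryProgram.numRest.eval w mem s = R.length :=
  L.eval_load (L.eval_const (by norm_num)) L.numRest

theorem eval_topLayer (L : Layout w mem P R X V bm cont) :
    QueryProgram.topLayer.eval w mem s = X := L.eval_load (L.eval_const (by norm_num)) L.topLayer

theorem eval_numEntries (L : Layout w mem P R X V bm cont) :
    QueryProgram.numEntries.eval w mem s = V.length :=
  L.eval_load (L.eval_const (by norm_num)) L.numEntries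

theorem eval_entry (L : Layout w mem P R X V bm cont) {e : Expr QReg} {i : ℕ}
    (he : e.eval w mem s = i) (hi : i < V.length) :
    (QueryProgram.entry e).eval w mem s = 4 + P.length + R.length + 4 * i := by
  have h1 := L.directory_le; have h2 := L.length_lt
  have h3 : i <<< 2 = 4 * i := by rw [Nat.shiftLeft_eq]; ring
  rw [← h3]
  exact eval_add (eval_add (eval_add (L.eval_const (by norm_num)) L.eval_numW (by omega))
    L.eval_numRest (by omega)) (eval_shl he (L.eval_const (by norm_num)) (by omega)) (by omega)

theorem eval_bit (L : Layout w mem P R X V bm cont) {e : Expr QReg} {p i : ℕ}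
    (he : e.eval w mem s = p) (hp : mem.getD p 0 = i) (hq : s .q = q) (hqw : q < 2 ^ w) :
    (bin .land (bin .shr (reg .q) (load e)) (const 1)).eval w mem s = (q.testBit i).toNat := by
  rw [← testBit_toNat_eq]
  exact eval_land (eval_shr (eval_reg hq hqw) (L.eval_load he hp)) (L.eval_const (by norm_num))

/-- One round of reading a bit of a restriction. -/
theorem eval_append_bit {v : QReg} (t : QReg) {x j K : ℕ} (hj : j < K) (hK : 2 ^ (K + 1) ≤ 2 ^ w)
    (hv : s v = x % 2 ^ j) (ht : s t = (x.testBit j).toNat) {u : QReg} (hu : s u = j) :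
    (bin .lor (reg v) (bin .shl (reg t) (reg u))).eval w mem s = x % 2 ^ (j + 1) := by
  have h1 : 2 ^ (j + 1) ≤ 2 ^ w := (Nat.pow_le_pow_right (by norm_num) (by omega)).trans hK
  have h2 : j + 1 < 2 ^ (j + 1) := Nat.lt_two_pow_self
  have h3 : x % 2 ^ j < 2 ^ j := Nat.mod_lt _ (by positivity)
  have h4 : 2 ^ j < 2 ^ (j + 1) := Nat.pow_lt_pow_right (by norm_num) (by omega)
  have h5 : (x.testBit j).toNat ≤ 1 := Bool.toNat_le _
  rw [← mod_two_pow_or_testBit]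
  refine eval_lor (eval_reg hv (by omega)) (eval_shl (eval_reg ht (by omega))
    (eval_reg hu (by omega)) ?_)
  rw [Nat.shiftLeft_eq]
  nlinarith

theorem runs_readW (L : Layout w mem P R X V bm cont) (hqw : q < 2 ^ w)
    (hs : Regs q 0 0 0 0 0 s) :
    Runs w mem QueryProgram.readW s (40 * (P.length + 1))
      (Regs q (restrict P q) 0 (layer P.length (restrict P q)) 0 0) := by
  set x := restrict P q with hx
  have hwP : P.length + 1 < 2 ^ (P.length + 1) := Nat.lt_two_pow_self
  have hP := L.pow_le
  have hloop := Runs.loop (w := w) (mem := mem) (B := 28)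
    (e := bin .lt (reg .j) QueryProgram.numW)
    (p := .block [
      .assign .bit (bin .land
        (bin .shr (reg .q) (load (bin .add (const 4) (reg .j)))) (const 1)),
      .assign .a (bin .lor (reg .a) (bin .shl (reg .bit) (reg .j))),
      .assign .cnt (bin .add (reg .cnt) (reg .bit)),
      .assign .j (bin .add (reg .j) (const 1))])
    -- The low `j` digits of the restriction have been assembled, and `cnt` counts the ones among
    -- them.
    (fun m s => ∃ j, j + m = P.length ∧ s QReg.j = j ∧ Regs q (x % 2 ^ j) 0 (layer j x) 0 0 s)
    (by
      rintro m s ⟨j, hjm, hj, hr⟩ he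
      rw [eval_lt_ne_zero L.word_pos (eval_reg hj (by omega)) L.eval_numW] at he
      refine ⟨m - 1, by omega, ?_⟩
      have hdir := L.directory_le; have hlen := L.length_lt
      have hl := layer_le j x
      have hb : (x.testBit j).toNat ≤ 1 := Bool.toNat_le _
      refine Runs.mono_time (Runs.assign_cons
        (L.eval_bit (eval_add (L.eval_const (by norm_num)) (eval_reg hj (by omega)) (by omega))
          (L.pos j he) hr.q hqw)
        (Runs.assign_cons (v := x % 2 ^ (j + 1)) ?_
          (Runs.assign_cons (v := layer j x + (x.testBit j).toNat) ?_
            (Runs.assign_cons (v := j + 1) ?_ (Runs.block_nil ?_)))))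
        (by simp [Expr.cost])
      · rw [← testBit_restrict he]
        exact eval_append_bit _ he L.pow_le (by simp [hr.a]) (by simp [hx]) (by simp [hj])
      · exact eval_add (eval_reg (by simp [hr.cnt]) (by omega))
          (eval_reg (by simp [hx, testBit_restrict he]) (by omega)) (by omega)
      · exact eval_add (eval_reg (by simp [hj]) (by omega)) (L.eval_const (by norm_num)) (by omega)
      · refine ⟨j + 1, by omega, by simp, ?_⟩
        constructor <;> simp [hr.q, hr.r, hr.b, hr.ans, layer_succ])
  refine Runs.mono (Runs.assign_cons (L.eval_const (by norm_num))
    (Runs.block_cons (B₂ := 1) ((hloop P.length ⟨0, by simp, by simp, ?_⟩).mono le_rfl ?_))) ?_ fun _ h => h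
  · constructor <;> simp [hs.q, hs.r, hs.b, hs.ans, hs.a, hs.cnt, layer, Nat.mod_one]
  · rintro s' ⟨⟨m, j, hjm, hj, hr⟩, he⟩
    rw [eval_lt_eq_zero L.word_pos (eval_reg hj (by omega)) L.eval_numW] at he
    obtain rfl : j = P.length := by omega
    rw [Nat.mod_eq_of_lt (restrict_lt P q)] at hr
    exact Runs.block_nil hr
  · simp [Expr.cost, QueryProgram.numW]; omega

theorem runs_readRest (L : Layout w mem P R X V bm cont) (hqw : q < 2 ^ w)
    (hs : Regs q a 0 cnt 0 0 s) :
    Runs w mem QueryProgram.readRest s (40 * (R.length + 1))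
      (Regs q a (restrict R q) cnt 0 0) := by
  set x := restrict R q with hx
  have hwP : R.length + 1 < 2 ^ (R.length + 1) := Nat.lt_two_pow_self
  have hP := L.pow_le'
  have hloop := Runs.loop (w := w) (mem := mem) (B := 28)
    (e := bin .lt (reg .j) QueryProgram.numRest)
    (p := .block [
      .assign .bit (bin .land
        (bin .shr (reg .q) (load (bin .add (bin .add (const 4) QueryProgram.numW) (reg .j))))
        (const 1)),
      .assign .r (bin .lor (reg .r) (bin .shl (reg .bit) (reg .j))),
      .assign .j (bin .add (reg .j) (const 1))])
    (fun m s => ∃ j, j + m = R.length ∧ s QReg.j = j ∧ Regs q a (x % 2 ^ j) cnt 0 0 s)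
    (by
      rintro m s ⟨j, hjm, hj, hr⟩ he
      rw [eval_lt_ne_zero L.word_pos (eval_reg hj (by omega)) L.eval_numRest] at he
      refine ⟨m - 1, by omega, ?_⟩
      have hdir := L.directory_le; have hlen := L.length_lt
      refine Runs.mono_time (Runs.assign_cons
        (L.eval_bit (eval_add (eval_add (L.eval_const (by norm_num)) L.eval_numW (by omega))
          (eval_reg hj (by omega)) (by omega)) (L.pos' j he) hr.q hqw)
        (Runs.assign_cons (v := x % 2 ^ (j + 1)) ?_
            (Runs.assign_cons (v := j + 1) ?_ (Runs.block_nil ?_))))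
        (by simp [Expr.cost, QueryProgram.numW])
      · rw [← testBit_restrict he]
        exact eval_append_bit _ he L.pow_le' (by simp [hr.r]) (by simp [hx]) (by simp [hj])
      · exact eval_add (eval_reg (by simp [hj]) (by omega)) (L.eval_const (by norm_num)) (by omega)
      · refine ⟨j + 1, by omega, by simp, ?_⟩
        constructor <;> simp [hr.q, hr.a, hr.b, hr.ans, hr.cnt])
  refine Runs.mono (Runs.assign_cons (L.eval_const (by norm_num))
    (Runs.block_cons (B₂ := 1) ((hloop R.length ⟨0, by simp, by simp, ?_⟩).mono le_rfl ?_))) ?_ fun _ h => h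
  · constructor <;> simp [hs.q, hs.r, hs.b, hs.ans, hs.a, hs.cnt, Nat.mod_one]
  · rintro s' ⟨⟨m, j, hjm, hj, hr⟩, he⟩
    rw [eval_lt_eq_zero L.word_pos (eval_reg hj (by omega)) L.eval_numRest] at he
    obtain rfl : j = R.length := by omega
    rw [Nat.mod_eq_of_lt (restrict_lt R q)] at hr
    exact Runs.block_nil hr
  · simp [Expr.cost, QueryProgram.numRest]; omega

/-- The vertices are distinct codes below `2 ^ P.length`; therefore binary search needs only
`P.length + 1` rounds. -/
theorem length_le (L : Layout w mem P R X V bm cont) : V.length ≤ 2 ^ P.length := by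
  have h := Finset.card_le_card (s := V.toFinset) (t := Finset.range (2 ^ P.length))
    (fun α hα => Finset.mem_range.2 (L.vertex_lt α (List.mem_toFinset.1 hα)))
  rwa [List.toFinset_card_of_nodup (L.sorted.imp fun h => h.ne), Finset.card_range] at h

theorem runs_search (L : Layout w mem P R X V bm cont) (hb : b < 2 ^ w)
    (hs : Regs q a r cnt b ans s) :
    Runs w mem QueryProgram.search s (50 * (P.length + 2)) fun s' =>
      Regs q a r cnt b ans s' ∧ s' .lo ≤ V.length ∧
        (∀ i (h : i < V.length), i < s' .lo → V[i] < b) ∧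
        ∀ i (h : i < V.length), s' .lo ≤ i → b ≤ V[i] := by
  have hdir := L.directory_le; have hlen := L.length_lt
  have hloop := Runs.loop (w := w) (mem := mem) (B := 31)
    (e := bin .lt (reg .lo) (reg .hi))
    (p := .block [
      .assign .mid (bin .shr (bin .add (reg .lo) (reg .hi)) (const 1)),
      .ite (bin .lt (load (QueryProgram.entry (reg .mid))) (reg .b))
        (.assign .lo (bin .add (reg .mid) (const 1)))
        (.assign .hi (reg .mid))])
    -- Every round halves the interval, so its length stays below `2 ^ m` with `m` rounds left.
    -- Entries before `lo` are known to be smaller than `b`, those from `hi` on to be at least `b`.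
    (fun m s => Regs q a r cnt b ans s ∧ s .lo ≤ s .hi ∧ s .hi ≤ V.length ∧
      s .hi - s .lo < 2 ^ m ∧
      (∀ i (h : i < V.length), i < s .lo → V[i] < b) ∧
        ∀ i (h : i < V.length), s .hi ≤ i → b ≤ V[i])
    (by
      rintro m s ⟨hr, hlh, hhV, hm, hlo, hhi⟩ he
      rw [eval_lt_ne_zero L.word_pos (eval_reg rfl (by omega)) (eval_reg rfl (by omega))] at he
      obtain ⟨m, rfl⟩ : ∃ m', m = m' + 1 := by
        cases m with
        | zero => simp at hm; omega
        | succ m => exact ⟨m, rfl⟩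
      refine ⟨m, rfl, ?_⟩
      rw [pow_succ] at hm
      have hmid : (s .lo + s .hi) >>> 1 = (s .lo + s .hi) / 2 := by
        rw [Nat.shiftRight_eq_div_pow, pow_one]
      set mid := (s .lo + s .hi) / 2 with hmid'
      have hmV : mid < V.length := by omega
      refine Runs.mono_time (Runs.assign_cons (v := mid) (hmid ▸
        (eval_shr (eval_add (eval_reg rfl (by omega)) (eval_reg rfl (by omega)) (by omega))
          (L.eval_const (by norm_num))))
        (Runs.block_cons (B₁ := 20) (B₂ := 1) (Runs.mono_time (Runs.ite (B := 4) ?_ ?_)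
          (by simp [Expr.cost, QueryProgram.entry, QueryProgram.numW, QueryProgram.numRest]))))
        (by simp [Expr.cost])
      · intro hlt
        rw [eval_lt_ne_zero L.word_pos (L.eval_load (L.eval_entry (eval_reg (Function.update_self ..)
          (by omega)) hmV) (L.vertex _ hmV)) (eval_reg (by simp [hr.b]) hb)] at hlt
        refine (Runs.assign (v := mid + 1) (eval_add (eval_reg (by simp) (by omega))
          (L.eval_const (by norm_num)) (by omega)) (Runs.block_nil ?_)).mono_time
            (by simp [Expr.cost])
        refine ⟨(hr.update (by decide)).update (by decide), by simp; omega, by simp; omega,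
          by simp; omega, ?_, by simpa using hhi⟩
        simp only [Function.update_self]
        intro i hi hi'
        rcases (Nat.lt_succ_iff.1 hi').lt_or_eq with h | rfl
        · exact (List.pairwise_iff_getElem.1 L.sorted _ _ hi hmV h).trans hlt
        · exact hlt
      · intro hlt
        rw [eval_lt_eq_zero L.word_pos (L.eval_load (L.eval_entry (eval_reg (Function.update_self ..)
          (by omega)) hmV) (L.vertex _ hmV)) (eval_reg (by simp [hr.b]) hb)] at hlt
        refine (Runs.assign (v := mid) (eval_reg (by simp) (by omega)) (Runs.block_nil ?_)).mono_time
            (by simp [Expr.cost])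
        refine ⟨(hr.update (by decide)).update (by decide), by simp; omega, by simp; omega,
          by simp; omega, by simpa using hlo, ?_⟩
        simp only [Function.update_self]
        intro i hi hi'
        rcases hi'.lt_or_eq with h | rfl
        · exact hlt.trans (List.pairwise_iff_getElem.1 L.sorted _ _ hmV hi h).le
        · exact hlt)
  refine Runs.mono (Runs.assign_cons (L.eval_const (by norm_num))
    (Runs.assign_cons L.eval_numEntries
      (Runs.block_cons (B₂ := 1) ((hloop (P.length + 1) ⟨(hs.update (by decide)).update (by decide),
        by simp, by simp, ?_, by simp, ?_⟩).mono le_rfl ?_)))) ?_ fun _ h => h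
  · have := L.length_le
    have : 0 < 2 ^ P.length := by positivity
    simp only [Function.update_self, ne_eq, reduceCtorEq, not_false_eq_true,
      Function.update_of_ne, pow_succ]
    omega
  · simp only [Function.update_self]
    intro i hi hi'; omega
  · rintro s' ⟨⟨m, hr, hlh, hhV, -, hlo, hhi⟩, he⟩
    rw [eval_lt_eq_zero L.word_pos (eval_reg rfl (by omega)) (eval_reg rfl (by omega))] at he
    have : s' .lo = s' .hi := by omega
    refine Runs.block_nil ⟨hr, by omega, hlo, by rwa [this]⟩
  · simp [Expr.cost, QueryProgram.numEntries]; omega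

end Layout

/-! ### Examining contents and traversing the query graph -/

open Classical in
/-- The truth value of a proposition, as a word. -/
noncomputable def truthValue (A : Prop) : ℕ := if A then 1 else 0

theorem truthValue_le (A : Prop) : truthValue A ≤ 1 := by unfold truthValue; split <;> omega

theorem truthValue_of_not {A : Prop} (h : ¬ A) : truthValue A = 0 := if_neg h

theorem truthValue_or (A B : Prop) : truthValue A ||| truthValue B = truthValue (A ∨ B) := by
  by_cases hA : A <;> by_cases hB : B <;> simp [truthValue, hA, hB]

theorem truthValue_congr {A B : Prop} (h : A ↔ B) : truthValue A = truthValue B := by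
  rw [propext h]

/-- For a query `q` with restriction `r` to the coordinates outside `W`, the proposition `hit α`
is decided by the content of `α`, which has at most `T` elements if it is a list. -/
structure Decides (V : List ℕ) (bm : ℕ → Prop) (cont : ℕ → List ℕ) (q r T : ℕ) (hit : ℕ → Prop) :
    Prop where
  lt_length : ∀ α ∈ V, bm α → r < (cont α).length
  bitmap : ∀ α ∈ V, bm α → (cont α).getD r 0 = truthValue (hit α)
  list : ∀ α ∈ V, ¬ bm α → (hit α ↔ ∃ u ∈ cont α, u &&& q = 0)
  length_le : ∀ α ∈ V, ¬ bm α → (cont α).length ≤ T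

namespace Layout

open Expr

variable {w : ℕ} {mem P R : List ℕ} {X : ℕ} {V : List ℕ} {bm : ℕ → Prop} {cont : ℕ → List ℕ}
  {s : QReg → ℕ} {q a r cnt b T : ℕ} {hit : ℕ → Prop} {A : Prop}

theorem runs_scan (L : Layout w mem P R X V bm cont) (hq : q < 2 ^ w) {l : List ℕ} {p : ℕ}
    (hp : p + l.length ≤ mem.length)
    (hl : ∀ j (hj : j < l.length), mem.getD (p + j) 0 = l[j])
    (hs : Regs q a r cnt b (truthValue A) s) (hptr : s .ptr = p) (hfin : s .fin = p + l.length) :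
    Runs w mem (.loop (bin .lt (reg .ptr) (reg .fin)) (.block [
          .assign .ans (bin .lor (reg .ans)
            (bin .eq (bin .land (load (reg .ptr)) (reg .q)) (const 0))),
          .assign .ptr (bin .add (reg .ptr) (const 1))])) s (20 * (l.length + 1))
      (Regs q a r cnt b (truthValue (A ∨ ∃ u ∈ l, u &&& q = 0))) := by
  have hlen := L.length_lt
  have hloop := Runs.loop (w := w) (mem := mem) (B := 14)
    (e := bin .lt (reg .ptr) (reg .fin))
    (p := .block [
          .assign .ans (bin .lor (reg .ans)
            (bin .eq (bin .land (load (reg .ptr)) (reg .q)) (const 0))),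
          .assign .ptr (bin .add (reg .ptr) (const 1))])
    -- `ans` accumulates the disjunction over the first `j` vectors, starting from the earlier
    -- answer `A`.
    (fun m s => ∃ j, j + m = l.length ∧ s QReg.ptr = p + j ∧ s QReg.fin = p + l.length ∧
      Regs q a r cnt b (truthValue (A ∨ ∃ u ∈ l.take j, u &&& q = 0)) s)
    (by
      rintro m s ⟨j, hjm, hj, hf, hr⟩ he
      rw [eval_lt_ne_zero L.word_pos (eval_reg hj (by omega)) (eval_reg hf (by omega))] at he
      have hjl : j < l.length := by omega
      refine ⟨m - 1, by omega, ?_⟩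
      refine Runs.mono_time (Runs.assign_cons
        (v := truthValue (A ∨ ∃ u ∈ l.take (j + 1), u &&& q = 0)) ?_
        (Runs.assign_cons (v := p + (j + 1)) ?_ (Runs.block_nil ?_))) (by simp [Expr.cost])
      · have h1 := truthValue_le (A ∨ ∃ u ∈ l.take j, u &&& q = 0)
        have h2 := eval_lor (eval_reg hr.ans (by have := L.const_lt (i := 1) (by norm_num); omega))
          (eval_eq L.word_pos (eval_land (L.eval_load (eval_reg hj (by omega)) (hl j hjl))
            (eval_reg hr.q hq)) (L.eval_const (i := 0) (by norm_num)))
        have h3 : (if l[j] &&& q = 0 then 1 else 0) = truthValue (l[j] &&& q = 0) := by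
          simp [truthValue]
        rw [h3, truthValue_or] at h2
        rw [h2]
        refine truthValue_congr ?_
        rw [List.take_add_one, List.getElem?_eq_getElem hjl]
        simp only [Option.toList_some, List.mem_append, List.mem_singleton, or_and_right, exists_or,
          exists_eq_left, or_assoc]
      · rw [← add_assoc]
        exact eval_add (eval_reg (by simp [hj]) (by omega)) (L.eval_const (by norm_num)) (by omega)
      · exact ⟨j + 1, by omega, by simp, by simp [hf], hr.update_ans.update (by decide)⟩)
  refine (hloop l.length ⟨0, by simp, hptr, hfin, by simpa using hs⟩).mono ?_ ?_
  · simp [Expr.cost]; omega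
  · rintro s' ⟨⟨m, j, hjm, hj, hf, hr⟩, he⟩
    rw [eval_lt_eq_zero L.word_pos (eval_reg hj (by omega)) (eval_reg hf (by omega))] at he
    obtain rfl : j = l.length := by omega
    simpa using hr

theorem runs_examine (L : Layout w mem P R X V bm cont) (D : Decides V bm cont q r T hit)
    (hq : q < 2 ^ w) (hs : Regs q a r cnt b (truthValue A) s) {i : ℕ} (hi : i < V.length)
    (hent : s .ent = 4 + P.length + R.length + 4 * i) :
    Runs w mem QueryProgram.examine s (20 * (T + 1) + 40)
      (Regs q a r cnt b (truthValue (A ∨ hit V[i]))) := by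
  have hlen := L.length_lt; have hdir := L.directory_le
  have hc := L.content_le i hi
  have hA := truthValue_le A
  have h1 := L.const_lt (i := 1) (by norm_num)
  refine Runs.mono_time (Runs.assign_cons (L.eval_load (eval_add (eval_reg hent (by omega))
    (L.eval_const (by norm_num)) (by omega)) rfl)
    (Runs.block_cons (B₂ := 1) (B₁ := 20 * (T + 1) + 30) (Runs.mono_time
      (Runs.ite (B := 20 * (T + 1) + 20) ?_ ?_) (by simp [Expr.cost]; omega)))) (by simp [Expr.cost]; omega)
  · intro hf
    rw [L.eval_load (eval_add (eval_reg (by simp [hent]; rfl) (by omega))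
      (L.eval_const (by norm_num)) (by omega)) rfl] at hf
    have hbm : bm V[i] := by
      by_contra hbm; exact hf (L.flag_zero i hi hbm)
    have hV : V[i] ∈ V := List.getElem_mem hi
    -- The restriction of the query indexes a cell inside the bitmap, so the lookup does not run
    -- into the next content.
    have hr := D.lt_length _ hV hbm
    have hv := L.content i hi r hr
    rw [← List.getD_eq_getElem _ 0 hr, D.bitmap _ hV hbm] at hv
    refine Runs.mono_time (Runs.assign (v := truthValue (A ∨ hit V[i])) ?_
      (Runs.block_nil (hs.update (by decide)).update_ans)) (by simp [Expr.cost])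
    rw [← truthValue_or]
    exact eval_lor (eval_reg (by simp [hs.ans]) (by omega)) (L.eval_load (eval_add
      (eval_reg (Function.update_self ..) (by omega))
      (eval_reg (by simp [hs.r]) (by omega)) (by omega)) hv)
  · intro hf
    rw [L.eval_load (eval_add (eval_reg (by simp [hent]; rfl) (by omega))
      (L.eval_const (by norm_num)) (by omega)) rfl] at hf
    have hbm : ¬ bm V[i] := by
      intro hbm; rw [L.flag_one i hi hbm] at hf; omega
    have hV : V[i] ∈ V := List.getElem_mem hi
    have hT := D.length_le _ hV hbm
    refine Runs.mono_time (Runs.assign_cons (eval_add (eval_reg (Function.update_self ..) (by omega))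
      (L.eval_load (eval_add (eval_reg (by simp [hent]) (by omega))
      (L.eval_const (by norm_num)) (by omega)) (L.content_length i hi)) (by omega))
      (Runs.block_cons (B₂ := 1) ((L.runs_scan hq hc (L.content i hi)
        ((hs.update (by decide)).update (by decide)) (by simp) (by simp)).mono le_rfl ?_)))
      (by simp [Expr.cost]; omega)
    intro s' hs'
    rw [truthValue_congr (or_congr Iff.rfl (D.list _ hV hbm).symm)] at hs'
    exact Runs.block_nil (Runs.block_nil hs')

/-- A vertex that is not in the directory has nothing to contribute, which is why `b` is not assumed
to be stored: the answer is extended by `b ∈ V ∧ hit b`. -/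
theorem runs_visit (L : Layout w mem P R X V bm cont) (D : Decides V bm cont q r T hit)
    (hq : q < 2 ^ w) (hb : b < 2 ^ w) (hs : Regs q a r cnt b (truthValue A) s) :
    Runs w mem QueryProgram.visit s (50 * (P.length + 2) + 20 * (T + 1) + 80)
      (Regs q a r cnt b (truthValue (A ∨ (b ∈ V ∧ hit b)))) := by
  have hlen := L.length_lt; have hdir := L.directory_le
  refine Runs.mono_time (Runs.block_cons (B₂ := 20 * (T + 1) + 79)
    ((L.runs_search hb hs).mono le_rfl ?_)) (by omega)
  rintro s' ⟨hr, hlo, h1, h2⟩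
  -- Since the directory is sorted, the first entry that is at least `b` equals `b` if `b` occurs at
  -- all.
  have hmem : b ∈ V → ∃ h : s' .lo < V.length, V[s' .lo] = b := by
    intro hbV
    obtain ⟨i, hi, rfl⟩ := List.getElem_of_mem hbV
    have h3 : s' .lo ≤ i := by
      by_contra h; exact lt_irrefl _ (h1 i hi (not_le.1 h))
    refine ⟨by omega, le_antisymm ?_ (h2 _ (by omega) le_rfl)⟩
    rcases h3.lt_or_eq with h | h
    · exact (List.pairwise_iff_getElem.1 L.sorted _ _ (by omega) hi h).le
    · simp [h]
  have hnot : ¬ b ∈ V → Regs q a r cnt b (truthValue (A ∨ (b ∈ V ∧ hit b))) s' := by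
    intro h; simpa [h] using hr
  refine Runs.mono_time (Runs.block_cons (B₁ := 20 * (T + 1) + 78) (B₂ := 1) (Runs.mono_time
    (Runs.ite (B := 20 * (T + 1) + 72) ?_ ?_)
      (by simp [Expr.cost, QueryProgram.numEntries]; omega))) (by omega)
  · intro hlt
    rw [eval_lt_ne_zero L.word_pos (eval_reg rfl (by omega)) L.eval_numEntries] at hlt
    refine Runs.mono_time (Runs.assign_cons (L.eval_entry (eval_reg rfl (by omega)) hlt)
      (Runs.block_cons (B₁ := 20 * (T + 1) + 50) (B₂ := 1)
        (Runs.mono_time (Runs.ite (B := 20 * (T + 1) + 40) ?_ ?_) (by simp [Expr.cost]; omega)))) (by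
          simp [Expr.cost, QueryProgram.entry, QueryProgram.numW, QueryProgram.numRest]; omega)
    all_goals
      intro he
      rw [eval_eq L.word_pos (L.eval_load (eval_reg (Function.update_self ..) (by omega))
        (L.vertex _ hlt)) (eval_reg (by simp [hr.b]) hb)] at he
    · have he : V[s' .lo] = b := by by_contra h; simp [h] at he
      refine (L.runs_examine D hq (hr.update (by decide)) hlt (by simp)).mono le_rfl ?_
      intro s'' hs''
      rw [he] at hs''
      have : b ∈ V := he ▸ List.getElem_mem hlt
      exact Runs.block_nil (Runs.block_nil (by simpa [this] using hs''))
    · have he : V[s' .lo] ≠ b := by intro h; simp [h] at he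
      refine (Runs.skip (Runs.block_nil (Runs.block_nil ?_))).mono_time (by omega)
      exact (hnot fun h => he (hmem h).2).update (by decide)
  · intro hlt
    rw [eval_lt_eq_zero L.word_pos (eval_reg rfl (by omega)) L.eval_numEntries] at hlt
    exact (Runs.skip (Runs.block_nil (hnot fun h => absurd (hmem h).1 (by omega)))).mono_time
      (by omega)

theorem two_pow_lt (L : Layout w mem P R X V bm cont) : 2 ^ P.length < 2 ^ w :=
  lt_of_lt_of_le (Nat.pow_lt_pow_right (by norm_num) (by omega)) L.pow_le

theorem eval_bound (L : Layout w mem P R X V bm cont) :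
    (bin .shl (const 1) QueryProgram.numW).eval w mem s = 2 ^ P.length := by
  have := eval_shl (a := 1) (w := w) (mem := mem) (s := s) (L.eval_const (by norm_num)) L.eval_numW
    (by rw [Nat.one_shiftLeft]; exact L.two_pow_lt)
  rwa [Nat.one_shiftLeft] at this

theorem runs_traverse_top (L : Layout w mem P R X V bm cont) (D : Decides V bm cont q r T hit)
    (hq : q < 2 ^ w) (ha : a < 2 ^ P.length) (hcnt : cnt ≤ X) (hs : Regs q a r cnt 0 0 s) :
    Runs w mem QueryProgram.traverse s (2 * (50 * (P.length + 2) + 20 * (T + 1) + 150))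
      fun s' => s' .ans = truthValue (a ∈ V ∧ hit a) := by
  have hK := L.two_pow_lt
  have hX : X < 2 ^ w := L.topLayer ▸ L.getD_lt 2
  have hloop := Runs.loop (w := w) (mem := mem) (B := 50 * (P.length + 2) + 20 * (T + 1) + 110)
    (e := bin .lt (reg .b) (bin .shl (const 1) QueryProgram.numW))
    (p := .block [
      QueryProgram.visit,
      .ite (bin .lt QueryProgram.topLayer (reg .cnt))
        (.assign .b (bin .lor (bin .add (reg .b) (const 1)) (reg .a)))
        (.assign .b (bin .shl (const 1) QueryProgram.numW))])
    -- The loop makes exactly one round: after the visit, `b` is set to `2 ^ P.length` and the guard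
    -- fails.
    (fun m s => (m = 1 ∧ Regs q a r cnt a (truthValue False) s) ∨
      (m = 0 ∧ Regs q a r cnt (2 ^ P.length) (truthValue (False ∨ a ∈ V ∧ hit a)) s))
    (by
      rintro m s (⟨rfl, hr⟩ | ⟨rfl, hr⟩) he
      · refine ⟨0, rfl, Runs.mono_time (Runs.block_cons (B₂ := 25)
          ((L.runs_visit D hq (by omega) hr).mono le_rfl ?_)) (by omega)⟩
        intro s' hs'
        refine Runs.mono_time (Runs.block_cons (B₁ := 24) (B₂ := 1)
          (Runs.mono_time (Runs.ite (B := 10) ?_ ?_)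
            (by simp [Expr.cost, QueryProgram.topLayer]))) (by omega)
        · intro h
          rw [eval_lt_ne_zero L.word_pos L.eval_topLayer (eval_reg hs'.cnt (by omega))] at h
          omega
        · intro _
          exact Runs.mono_time (Runs.assign L.eval_bound
            (Runs.block_nil (Or.inr ⟨rfl, hs'.update_b⟩)))
            (by simp [Expr.cost, QueryProgram.numW])
      · rw [eval_lt_ne_zero L.word_pos (eval_reg hr.b (by omega)) L.eval_bound] at he
        omega)
  refine Runs.mono_time (Runs.assign_cons (eval_reg hs.a (by omega)) (Runs.block_cons (B₂ := 1)
    ((hloop 1 (Or.inl ⟨rfl, ?_⟩)).mono le_rfl ?_))) ?_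
  · rw [truthValue_of_not (fun h => h)]; exact hs.update_b
  · rintro s' ⟨⟨m, ⟨rfl, hr⟩ | ⟨rfl, hr⟩⟩, he⟩
    · rw [eval_lt_eq_zero L.word_pos (eval_reg hr.b (by omega)) L.eval_bound] at he
      omega
    · exact Runs.block_nil (hr.ans.trans (truthValue_congr (by simp)))
  · simp [Expr.cost, QueryProgram.numW]; omega

theorem runs_traverse (L : Layout w mem P R X V bm cont) (D : Decides V bm cont q r T hit)
    (hq : q < 2 ^ w) (ha : a < 2 ^ P.length) (hcnt : X < cnt) (hcw : cnt < 2 ^ w)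
    (hs : Regs q a r cnt 0 0 s) :
    Runs w mem QueryProgram.traverse s
      ((2 ^ (P.length - layer P.length a) + 1) * (50 * (P.length + 2) + 20 * (T + 1) + 150))
      fun s' => s' .ans = truthValue (∃ c ∈ V, c &&& a = a ∧ hit c) := by
  have hK := L.two_pow_lt
  have hK' := L.pow_le
  have hK1 : 2 ^ P.length < 2 ^ (P.length + 1) := Nat.pow_lt_pow_right (by norm_num) (by omega)
  have hloop := Runs.loop (w := w) (mem := mem) (B := 50 * (P.length + 2) + 20 * (T + 1) + 110)
    (e := bin .lt (reg .b) (bin .shl (const 1) QueryProgram.numW))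
    (p := .block [
      QueryProgram.visit,
      .ite (bin .lt QueryProgram.topLayer (reg .cnt))
        (.assign .b (bin .lor (bin .add (reg .b) (const 1)) (reg .a)))
        (.assign .b (bin .shl (const 1) QueryProgram.numW))])
    -- The loop measure bounds the number of supersets of `a` that are still to come. The current
    -- `b` is only known to be below `2 ^ w`, since the last step leaves the range of the vertices.
    (fun m s => ∃ b < 2 ^ w, b &&& a = a ∧
      ((Finset.range (2 ^ P.length)).filter fun c => c &&& a = a ∧ b ≤ c).card ≤ m ∧
      Regs q a r cnt b (truthValue (∃ c ∈ V, c < b ∧ c &&& a = a ∧ hit c)) s)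
    (by
      rintro m s ⟨b, hbw, hba, hm, hr⟩ he
      rw [eval_lt_ne_zero L.word_pos (eval_reg hr.b (by omega)) L.eval_bound] at he
      -- The spare bit in `pow_le` keeps the overshooting successor inside a word.
      have hnb : (b + 1) ||| a < 2 ^ (P.length + 1) := Nat.or_lt_two_pow (by omega) (by omega)
      have hss : ((Finset.range (2 ^ P.length)).filter fun c => c &&& a = a ∧ (b + 1) ||| a ≤ c) ⊂
          (Finset.range (2 ^ P.length)).filter fun c => c &&& a = a ∧ b ≤ c := by
        have hle : b + 1 ≤ (b + 1) ||| a := Nat.left_le_or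
        refine Finset.ssubset_iff_of_subset (fun c => ?_) |>.2 ⟨b, ?_, ?_⟩
        · simp only [Finset.mem_filter, Finset.mem_range]
          rintro ⟨h1, h2, h3⟩; exact ⟨h1, h2, by omega⟩
        · simp [he, hba]
        · simp only [Finset.mem_filter, Finset.mem_range, not_and, not_le]
          intros; omega
      have hlt := (Finset.card_lt_card hss).trans_le hm
      refine ⟨m - 1, by omega, Runs.mono_time (Runs.block_cons (B₂ := 25)
          ((L.runs_visit D hq hbw hr).mono le_rfl ?_)) (by omega)⟩
      intro s' hs'
      refine Runs.mono_time (Runs.block_cons (B₁ := 24) (B₂ := 1)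
          (Runs.mono_time (Runs.ite (B := 10) ?_ ?_)
            (by simp [Expr.cost, QueryProgram.topLayer]))) (by omega)
      · intro _
        refine Runs.mono_time (Runs.assign (eval_lor (eval_add (eval_reg hs'.b hbw)
          (L.eval_const (by norm_num)) (by omega)) (eval_reg hs'.a (by omega)))
          (Runs.block_nil ⟨(b + 1) ||| a, by omega, ?_, by omega, ?_⟩)) (by simp [Expr.cost])
        · exact Nat.eq_of_testBit_eq fun i => by simp; grind
        -- By `succ_or_le` no superset of `a` lies strictly between `b` and its successor, so none
        -- is skipped.
        · have hiff : ((∃ c ∈ V, c < b ∧ c &&& a = a ∧ hit c) ∨ b ∈ V ∧ hit b) ↔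
              ∃ c ∈ V, c < (b + 1) ||| a ∧ c &&& a = a ∧ hit c := by
            have hle : b + 1 ≤ (b + 1) ||| a := Nat.left_le_or
            constructor
            · rintro (⟨c, h1, h2, h3⟩ | ⟨h1, h2⟩)
              · exact ⟨c, h1, by omega, h3⟩
              · exact ⟨b, h1, by omega, hba, h2⟩
            · rintro ⟨c, h1, h2, h3, h4⟩
              rcases lt_trichotomy c b with h | rfl | h
              · exact Or.inl ⟨c, h1, h, h3, h4⟩
              · exact Or.inr ⟨h1, h4⟩
              · exact absurd (succ_or_le hba h3 h) (by omega)
          rw [truthValue_congr hiff] at hs'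
          exact hs'.update_b
      · intro h
        rw [eval_lt_eq_zero L.word_pos L.eval_topLayer (eval_reg hs'.cnt hcw)] at h
        omega)
  refine Runs.mono_time (Runs.assign_cons (eval_reg hs.a (by omega)) (Runs.block_cons (B₂ := 1)
    ((hloop (2 ^ (P.length - layer P.length a)) ⟨a, by omega, by simp, ?_, ?_⟩).mono le_rfl ?_))) ?_
  · refine (Finset.card_le_card fun c => ?_).trans (card_supersets_le _ _)
    simp only [Finset.mem_filter]; tauto
  · rw [truthValue_of_not]
    · exact hs.update_b
    · rintro ⟨c, -, h1, h2, -⟩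
      have : c &&& a ≤ c := Nat.and_le_left
      omega
  · rintro s' ⟨⟨m, b, hbw, -, -, hr⟩, he⟩
    rw [eval_lt_eq_zero L.word_pos (eval_reg hr.b (by omega)) L.eval_bound] at he
    refine Runs.block_nil (hr.ans.trans (truthValue_congr ?_))
    refine exists_congr fun c => and_congr_right fun hc => ?_
    have := L.vertex_lt c hc
    simp only [and_iff_right_iff_imp]
    intro _; omega
  · rw [add_mul]
    refine le_trans ?_ (Nat.add_le_add_right (Nat.mul_le_mul_left _
      (show 50 * (P.length + 2) + 20 * (T + 1) + 110 + (bin .lt (reg QReg.b)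
        (bin .shl (const 1) QueryProgram.numW)).cost + 1 ≤ _ from ?_)) _)
    all_goals simp [Expr.cost, QueryProgram.numW] <;> omega

/-- The query algorithm is correct, and its running time is bounded by the number of visited
vertices. -/
theorem runs_query (L : Layout w mem P R X V bm cont)
    (D : Decides V bm cont q (restrict R q) T hit) (hq : q < 2 ^ w) (hs : Regs q 0 0 0 0 0 s) :
    ∃ M : ℕ, (M = 1 ∨ ∃ m, X < m ∧ m ≤ P.length ∧ M = 2 ^ (P.length - m)) ∧
      Runs w mem topLevelsQuery s (1000 * (P.length + R.length + 1) * (T + 1) * M)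
        fun s' => s' .ans = truthValue (if layer P.length (restrict P q) ≤ X
          then restrict P q ∈ V ∧ hit (restrict P q)
          else ∃ c ∈ V, c &&& restrict P q = restrict P q ∧ hit c) := by
  have hlay := layer_le P.length (restrict P q)
  -- Both traversals fit the form with `M + 1` rounds: `M = 1` in the top layers, and the number of
  -- supersets otherwise.
  have hbound : ∀ M, 1 ≤ M → 40 * (P.length + 1) + (40 * (R.length + 1) +
      ((M + 1) * (50 * (P.length + 2) + 20 * (T + 1) + 150) + 1)) ≤
      1000 * (P.length + R.length + 1) * (T + 1) * M := by
    intro M hM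
    have h1 : P.length + R.length + 1 ≤ (P.length + R.length + 1) * (T + 1) :=
      Nat.le_mul_of_pos_right _ (by omega)
    have h2 : T + 1 ≤ (P.length + R.length + 1) * (T + 1) :=
      Nat.le_mul_of_pos_left _ (by omega)
    set Z := (P.length + R.length + 1) * (T + 1) with hZ
    have h3 : Z ≤ Z * M := Nat.le_mul_of_pos_right _ (by omega)
    calc _ ≤ 100 * Z + (M + 1) * (300 * Z) := by
          have := Nat.mul_le_mul_left (M + 1)
            (show 50 * (P.length + 2) + 20 * (T + 1) + 150 ≤ 300 * Z by omega)
          omega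
      _ = 400 * Z + 300 * (Z * M) := by ring
      _ ≤ 1000 * (Z * M) := by omega
      _ = _ := by rw [hZ]; ring
  split
  · rename_i h
    refine ⟨1, Or.inl rfl, Runs.mono_time (Runs.block_cons ((L.runs_readW hq hs).mono le_rfl
      fun s₁ h₁ => Runs.block_cons ((L.runs_readRest hq h₁).mono le_rfl fun s₂ h₂ =>
        Runs.block_cons (B₂ := 1) ((L.runs_traverse_top D hq (restrict_lt _ _) h h₂).mono le_rfl
          fun s₃ h₃ => Runs.block_nil h₃)))) (hbound 1 le_rfl)⟩
  · rename_i h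
    refine ⟨2 ^ (P.length - layer P.length (restrict P q)), Or.inr ⟨_, not_le.1 h, hlay, rfl⟩,
      Runs.mono_time (Runs.block_cons ((L.runs_readW hq hs).mono le_rfl
      fun s₁ h₁ => Runs.block_cons ((L.runs_readRest hq h₁).mono le_rfl fun s₂ h₂ =>
        Runs.block_cons (B₂ := 1) ((L.runs_traverse D hq (restrict_lt _ _) (not_le.1 h) ?_
          h₂).mono le_rfl fun s₃ h₃ => Runs.block_nil h₃)))) (hbound _ Nat.one_le_two_pow)⟩
    have := L.directory_le; have := L.length_lt
    omega

end Layout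

/-! ### Orthogonality, complements and correctness of the answer -/

theorem restrict_and (P : List ℕ) (u v : ℕ) :
    restrict P u &&& restrict P v = restrict P (u &&& v) := by
  refine Nat.eq_of_testBit_eq fun j => ?_
  rcases lt_or_ge j P.length with h | h
  · simp [testBit_restrict h]
  · simp [testBit_restrict_ge h]

theorem restrict_eq_zero_iff {P : List ℕ} {v : ℕ} :
    restrict P v = 0 ↔ ∀ p ∈ P, v.testBit p = false := by
  constructor
  · intro h p hp
    obtain ⟨j, hj, rfl⟩ := List.getElem_of_mem hp
    rw [← testBit_restrict hj, h, Nat.zero_testBit]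
  · intro h
    refine Nat.eq_of_testBit_eq fun j => ?_
    rcases lt_or_ge j P.length with hj | hj
    · rw [testBit_restrict hj, h _ (List.getElem_mem hj), Nat.zero_testBit]
    · rw [testBit_restrict_ge hj, Nat.zero_testBit]

section

variable {d : ℕ}

theorem length_positions (W : Finset (Fin d)) : (positions W).length = W.card := by
  simp [positions]

theorem mem_positions {W : Finset (Fin d)} {p : ℕ} :
    p ∈ positions W ↔ ∃ i ∈ W, (i : ℕ) = p := by
  simp [positions, eq_comm]

theorem eq_zero_iff_restrict (W : Finset (Fin d)) {x : ℕ} (hx : x < 2 ^ d) :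
    x = 0 ↔ restrict (positions W) x = 0 ∧ restrict (positions Wᶜ) x = 0 := by
  simp only [restrict_eq_zero_iff, mem_positions]
  constructor
  · rintro rfl; simp
  · rintro ⟨h1, h2⟩
    refine Nat.eq_of_testBit_eq fun p => ?_
    rw [Nat.zero_testBit]
    rcases lt_or_ge p d with h | h
    · by_cases hW : (⟨p, h⟩ : Fin d) ∈ W
      · exact h1 _ ⟨_, hW, rfl⟩
      · exact h2 _ ⟨_, Finset.mem_compl.2 hW, rfl⟩
    · exact Nat.testBit_lt_two_pow (hx.trans_le (Nat.pow_le_pow_right (by norm_num) h))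

theorem and_eq_zero_iff_restrict (W : Finset (Fin d)) {u v : ℕ} (hu : u < 2 ^ d) :
    u &&& v = 0 ↔ restrict (positions W) u &&& restrict (positions W) v = 0 ∧
      restrict (positions Wᶜ) u &&& restrict (positions Wᶜ) v = 0 := by
  rw [restrict_and, restrict_and]
  exact eq_zero_iff_restrict W (lt_of_le_of_lt Nat.and_le_left hu)

theorem orthVec_iff (u v : Fin d → Bool) : OrthVec u v ↔ Nat.ofBits u &&& Nat.ofBits v = 0 := by
  unfold OrthVec dotProduct
  rw [Finset.sum_eq_zero_iff_of_nonneg (fun i _ => by positivity)]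
  constructor
  · intro h
    refine Nat.eq_of_testBit_eq fun j => ?_
    rcases lt_or_ge j d with hj | hj
    · have := h ⟨j, hj⟩ (Finset.mem_univ _)
      cases h1 : u ⟨j, hj⟩ <;> cases h2 : v ⟨j, hj⟩ <;> simp_all
    · simp [hj]
  · intro h i _
    have := congrArg (·.testBit i) h
    simp only [Nat.testBit_and, Nat.testBit_ofBits_lt _ _ i.2, Nat.zero_testBit, Fin.eta] at this
    cases h1 : u i <;> cases h2 : v i <;> simp_all

/-- The ones of `a` are ones of `c`, hence zeros of its complement `x`. Beyond digit `K` the numbers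
`x` and `c` agree instead, so there the bound on `a` is needed. -/
theorem and_eq_zero_of_xor {K x c a : ℕ} (hx : x ^^^ c = 2 ^ K - 1) (hc : c &&& a = a)
    (ha : a < 2 ^ K) : x &&& a = 0 := by
  refine Nat.eq_of_testBit_eq fun j => ?_
  have h1 := congrArg (·.testBit j) hx
  have h2 := congrArg (·.testBit j) hc
  simp only [Nat.testBit_xor, Nat.testBit_and, Nat.testBit_two_pow_sub_one, Nat.zero_testBit] at *
  rcases lt_or_ge j K with hj | hj
  · cases h3 : x.testBit j <;> cases h4 : c.testBit j <;> cases h5 : a.testBit j <;> simp_all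
  · simp [Nat.testBit_lt_two_pow (ha.trans_le (Nat.pow_le_pow_right (by norm_num) hj))]

theorem exists_complement {K x a : ℕ} (hx : x < 2 ^ K) (ha : a < 2 ^ K) (h : x &&& a = 0) :
    ∃ c < 2 ^ K, x ^^^ c = 2 ^ K - 1 ∧ c &&& a = a := by
  have hK : 2 ^ K - 1 < 2 ^ K := Nat.sub_lt (by positivity) one_pos
  refine ⟨x ^^^ (2 ^ K - 1), Nat.xor_lt_two_pow hx hK, by simp, ?_⟩
  refine Nat.eq_of_testBit_eq fun j => ?_
  have h1 := congrArg (·.testBit j) h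
  simp only [Nat.testBit_xor, Nat.testBit_and, Nat.testBit_two_pow_sub_one, Nat.zero_testBit] at *
  rcases lt_or_ge j K with hj | hj
  · cases h3 : x.testBit j <;> cases h5 : a.testBit j <;> simp_all
  · simp [Nat.testBit_lt_two_pow (ha.trans_le (Nat.pow_le_pow_right (by norm_num) hj))]

end

section

variable {d n : ℕ} (S : Fin n → Fin d → Bool) (W : Finset (Fin d)) (X T : ℕ)

theorem lt_of_mem_inputCodes {u : ℕ} (h : u ∈ inputCodes S) : u < 2 ^ d := by
  obtain ⟨i, rfl⟩ := (List.mem_ofFn' _ _).1 h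
  exact Nat.ofBits_lt_two_pow _

theorem length_bitmap (L : List ℕ) : (bitmap W L).length = 2 ^ (Wᶜ).card := by
  simp [bitmap]

theorem getD_bitmap (L : List ℕ) {r : ℕ} (hr : r < 2 ^ (Wᶜ).card) :
    (bitmap W L).getD r 0 = truthValue (∃ u ∈ L, restrict (positions Wᶜ) u &&& r = 0) := by
  rw [List.getD_eq_getElem _ _ (by rwa [length_bitmap])]
  simp [bitmap, truthValue]

theorem content_of_top {α : ℕ} (h : layer W.card α ≤ X) :
    content S W X T α = bitmap W (orthList S W α) := if_pos h

theorem content_of_long {α : ℕ} (h : ¬ layer W.card α ≤ X) (h' : T < (vertexList S W α).length) :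
    content S W X T α = bitmap W (vertexList S W α) := by
  rw [content, if_neg h, if_pos h']

theorem content_of_short {α : ℕ} (h : ¬ layer W.card α ≤ X)
    (h' : ¬ T < (vertexList S W α).length) : content S W X T α = vertexList S W α := by
  rw [content, if_neg h, if_neg h']

/-- Whether the content of the vertex `α` gives a positive answer to the query `q`. -/
def Hit (q α : ℕ) : Prop :=
  if hasBitmap S W X T α then
    ∃ u ∈ if layer W.card α ≤ X then orthList S W α else vertexList S W α,
      restrict (positions Wᶜ) u &&& restrict (positions Wᶜ) q = 0
  else ∃ u ∈ vertexList S W α, u &&& q = 0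

theorem decides (q : ℕ) :
    Decides (storedVertices S W X) (hasBitmap S W X T) (content S W X T) q
      (restrict (positions Wᶜ) q) T (Hit S W X T q) := by
  have hr : restrict (positions Wᶜ) q < 2 ^ (Wᶜ).card := by
    rw [← length_positions]; exact restrict_lt _ _
  refine ⟨fun α _ h => ?_, fun α _ h => ?_, fun α _ h => ?_, fun α _ h => ?_⟩
  · by_cases ht : layer W.card α ≤ X
    · rwa [content_of_top S W X T ht, length_bitmap]
    · rwa [content_of_long S W X T ht (h.resolve_left ht), length_bitmap]
  · rw [Hit, if_pos h]
    by_cases ht : layer W.card α ≤ X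
    · rw [content_of_top S W X T ht, getD_bitmap W _ hr, if_pos ht]
    · rw [content_of_long S W X T ht (h.resolve_left ht), getD_bitmap W _ hr, if_neg ht]
  · rw [Hit, if_neg h]
    rw [hasBitmap, not_or] at h
    rw [content_of_short S W X T h.1 h.2]
  · rw [hasBitmap, not_or] at h
    rw [content_of_short S W X T h.1 h.2]
    exact not_lt.1 h.2

theorem mem_storedVertices {α : ℕ} : α ∈ storedVertices S W X ↔
    α < 2 ^ W.card ∧ (layer W.card α ≤ X ∨ vertexList S W α ≠ []) := by
  simp [storedVertices]

/-- A bitmap tests orthogonality outside `W` only. This is enough at a vertex reachable from the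
restriction of `q`, because all vectors of its list are orthogonal to `q` on `W`. -/
theorem hit_iff_of_reachable {q α : ℕ} (ht : ¬ layer W.card α ≤ X)
    (hα : α &&& restrict (positions W) q = restrict (positions W) q) :
    Hit S W X T q α ↔ ∃ u ∈ vertexList S W α, u &&& q = 0 := by
  rw [Hit]
  by_cases hb : hasBitmap S W X T α
  · rw [if_pos hb, if_neg ht]
    refine exists_congr fun u => and_congr_right fun hu => ?_
    rw [vertexList, List.mem_filter, decide_eq_true_iff] at hu
    rw [and_eq_zero_iff_restrict W (lt_of_mem_inputCodes S hu.1), iff_and_self]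
    intro _
    refine and_eq_zero_of_xor hu.2 hα ?_
    rw [← length_positions]; exact restrict_lt _ _
  · rw [if_neg hb]

theorem answer_iff (v : Fin d → Bool) :
    (if layer W.card (restrict (positions W) (Nat.ofBits v)) ≤ X
      then restrict (positions W) (Nat.ofBits v) ∈ storedVertices S W X ∧
        Hit S W X T (Nat.ofBits v) (restrict (positions W) (Nat.ofBits v))
      else ∃ c ∈ storedVertices S W X, c &&& restrict (positions W) (Nat.ofBits v) =
        restrict (positions W) (Nat.ofBits v) ∧ Hit S W X T (Nat.ofBits v) c) ↔
    ∃ i, OrthVec (S i) v := by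
  have hrhs : (∃ i, OrthVec (S i) v) ↔ ∃ u ∈ inputCodes S, u &&& Nat.ofBits v = 0 := by
    simp [inputCodes, orthVec_iff, List.mem_ofFn]
  rw [hrhs]
  set q := Nat.ofBits v
  have ha : restrict (positions W) q < 2 ^ W.card := by
    rw [← length_positions]; exact restrict_lt _ _
  split
  · rename_i h
    have hb : hasBitmap S W X T (restrict (positions W) q) := Or.inl h
    rw [Hit, if_pos hb, if_pos h,
      and_iff_right ((mem_storedVertices S W X).2 ⟨ha, Or.inl h⟩)]
    simp only [orthList, List.mem_filter, decide_eq_true_iff, and_assoc]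
    refine exists_congr fun u => and_congr_right fun hu => ?_
    rw [and_eq_zero_iff_restrict W (lt_of_mem_inputCodes S hu)]
  · rename_i h
    constructor
    · rintro ⟨c, hc, hca, hit⟩
      have := layer_le_layer (K := W.card) hca
      rw [hit_iff_of_reachable S W X T (by omega) hca] at hit
      obtain ⟨u, hu, huq⟩ := hit
      exact ⟨u, List.mem_of_mem_filter hu, huq⟩
    · rintro ⟨u, hu, huq⟩
      have h1 := ((and_eq_zero_iff_restrict W (lt_of_mem_inputCodes S hu)).1 huq).1
      -- The witness is the complement of `u` on `W`: reachable because `u` and `q` are orthogonal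
      -- on `W`, and stored because its list contains `u`.
      obtain ⟨c, hc, hxc, hca⟩ := exists_complement
        (by rw [← length_positions]; exact restrict_lt _ _) ha h1
      have huc : u ∈ vertexList S W c := by
        rw [vertexList, List.mem_filter, decide_eq_true_iff]; exact ⟨hu, hxc⟩
      have := layer_le_layer (K := W.card) hca
      exact ⟨c, (mem_storedVertices S W X).2 ⟨hc, Or.inr (List.ne_nil_of_mem huc)⟩, hca,
        (hit_iff_of_reachable S W X T (by omega) hca).2 ⟨u, huc, huq⟩⟩

/-! ### The memory content realizes the layout -/

theorem length_directory (V : List ℕ) (p : ℕ) : (directory S W X T V p).length = 4 * V.length := by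
  induction V generalizing p with
  | nil => rfl
  | cons α V ih => simp [directory, ih]; ring

theorem directory_getD (V : List ℕ) (p i : ℕ) (hi : i < V.length) :
    (directory S W X T V p).getD (4 * i) 0 = V[i] ∧
    (directory S W X T V p).getD (4 * i + 1) 0 = (if hasBitmap S W X T V[i] then 1 else 0) ∧
    (directory S W X T V p).getD (4 * i + 2) 0 =
      p + ((V.take i).flatMap (content S W X T)).length ∧
    (directory S W X T V p).getD (4 * i + 3) 0 = (content S W X T V[i]).length := by
  induction V generalizing p i with
  | nil => simp at hi
  | cons α V ih =>
    cases i with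
    | zero => simp [directory]
    | succ i =>
      have := ih (p + (content S W X T α).length) i (by simpa using hi)
      have e : ∀ j, 4 * (i + 1) + j = 4 * i + j + 4 := fun j => by ring
      have e0 : 4 * (i + 1) = 4 * i + 4 := by ring
      rw [e, e, e, e0]
      simpa [directory, add_assoc] using this

theorem mem_directory {V : List ℕ} {p a : ℕ} (ha : a ∈ directory S W X T V p) :
    a ∈ V ∨ a ≤ 1 ∨ a ≤ p + (V.flatMap (content S W X T)).length := by
  induction V generalizing p with
  | nil => simp [directory] at ha
  | cons α V ih =>
    simp only [directory, List.cons_append, List.nil_append, List.mem_cons] at ha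
    simp only [List.mem_cons, List.flatMap_cons, List.length_append]
    rcases ha with rfl | rfl | rfl | rfl | ha
    · simp
    · right; left; split <;> simp
    · omega
    · omega
    · rcases ih ha with h | h | h
      · simp [h]
      · simp [h]
      · omega

/-- The offset is the total length of the earlier contents, exactly what `directory_getD` finds in
the pointer cell. -/
theorem flatMap_getD {f : ℕ → List ℕ} (V : List ℕ) (i : ℕ) (hi : i < V.length) (j : ℕ)
    (hj : j < (f V[i]).length) :
    (V.flatMap f).getD (((V.take i).flatMap f).length + j) 0 = (f V[i])[j] := by
  induction V generalizing i with
  | nil => simp at hi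
  | cons α V ih =>
    cases i with
    | zero =>
      simp only [List.getElem_cons_zero] at hj ⊢
      simp [List.getElem?_append_left hj, List.getElem?_eq_getElem hj]
    | succ i =>
      have := ih i (by simpa using hi) (by simpa using hj)
      simp only [List.take_succ_cons, List.flatMap_cons, List.length_append,
        List.getElem_cons_succ] at this ⊢
      rw [List.getD_append_right _ _ _ _ (by omega), ← this]
      congr 1; omega

theorem length_flatMap_take_add_le {f : ℕ → List ℕ} (V : List ℕ) (i : ℕ) (hi : i < V.length) :
    ((V.take i).flatMap f).length + (f V[i]).length ≤ (V.flatMap f).length := by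
  conv_rhs => rw [← List.take_append_drop i V, List.drop_eq_getElem_cons hi]
  simp only [List.flatMap_append, List.flatMap_cons, List.length_append]
  omega

theorem length_topLevelsMemory : (topLevelsMemory S W X T).length =
    4 + d + 4 * (storedVertices S W X).length +
      ((storedVertices S W X).flatMap (content S W X T)).length := by
  have h : W.card + (Wᶜ).card = d := by
    rw [Finset.card_add_card_compl, Fintype.card_fin]
  rw [topLevelsMemory]
  simp only [List.length_append, length_positions, length_directory, List.length_cons,
    List.length_nil]
  omega

theorem content_lt {α a : ℕ} (ha : a ∈ content S W X T α) : a ≤ 1 ∨ a < 2 ^ d := by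
  have hb : ∀ L, a ∈ bitmap W L → a ≤ 1 := by
    intro L h
    rw [bitmap, List.mem_map] at h
    obtain ⟨r, -, rfl⟩ := h
    split <;> simp
  rw [content] at ha
  split at ha
  · exact Or.inl (hb _ ha)
  · split at ha
    · exact Or.inl (hb _ ha)
    · exact Or.inr (lt_of_mem_inputCodes S (List.mem_of_mem_filter ha))

/-- Apart from the header and small flags, every cell is a coordinate, a vertex or vector code,
controlled by `2 ^ d`, or an address or content length, controlled by the memory length. -/
theorem memory_lt_word {w : ℕ} (hd : 2 ^ (d + 1) ≤ 2 ^ w) (hX : X < 2 ^ w)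
    (hlen : (topLevelsMemory S W X T).length < 2 ^ w) :
    ∀ a ∈ topLevelsMemory S W X T, a < 2 ^ w := by
  have h : W.card + (Wᶜ).card = d := by
    rw [Finset.card_add_card_compl, Fintype.card_fin]
  have hK : 2 ^ W.card ≤ 2 ^ d := Nat.pow_le_pow_right (by norm_num) (by omega)
  have hd' : d < 2 ^ d := Nat.lt_two_pow_self
  rw [pow_succ] at hd
  rw [length_topLevelsMemory] at hlen
  intro a ha
  simp only [topLevelsMemory, List.mem_append, List.mem_cons, List.not_mem_nil, or_false] at ha
  rcases ha with ((((rfl | rfl | rfl | rfl) | ha) | ha) | ha) | ha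
  · omega
  · omega
  · exact hX
  · omega
  · obtain ⟨i, -, rfl⟩ := mem_positions.1 ha
    have := i.2; omega
  · obtain ⟨i, -, rfl⟩ := mem_positions.1 ha
    have := i.2; omega
  · rcases mem_directory S W X T ha with h | h | h
    · have := ((mem_storedVertices S W X).1 h).1
      omega
    · omega
    · omega
  · obtain ⟨α, -, hα⟩ := List.mem_flatMap.1 ha
    rcases content_lt S W X T hα with h | h <;> omega

theorem layout {w : ℕ} (hd : 2 ^ (d + 1) ≤ 2 ^ w) (hX : X < 2 ^ w)
    (hlen : (topLevelsMemory S W X T).length < 2 ^ w) :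
    Layout w (topLevelsMemory S W X T) (positions W) (positions Wᶜ) X (storedVertices S W X)
      (hasBitmap S W X T) (content S W X T) := by
  have h : W.card + (Wᶜ).card = d := by
    rw [Finset.card_add_card_compl, Fintype.card_fin]
  have hlenm := length_topLevelsMemory S W X T
  set V := storedVertices S W X with hV
  set mem := topLevelsMemory S W X T with hmem
  have hP := length_positions W
  have hR := length_positions Wᶜ
  have hmem' : mem = [W.card, (Wᶜ).card, X, V.length] ++ (positions W ++ (positions Wᶜ ++
      (directory S W X T V (4 + d + 4 * V.length) ++ V.flatMap (content S W X T)))) := by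
    simp [hmem, topLevelsMemory, ← hV]
  have hdir : ∀ i < 4 * V.length, mem.getD (4 + (positions W).length + (positions Wᶜ).length + i) 0
      = (directory S W X T V (4 + d + 4 * V.length)).getD i 0 := by
    intro i hi
    rw [hmem', List.getD_append_right _ _ _ _ (by simp; omega),
      List.getD_append_right _ _ _ _ (by simp; omega),
      List.getD_append_right _ _ _ _ (by simp; omega),
      List.getD_append _ _ _ _ (by rw [length_directory]; simp; omega)]
    congr 1; simp; omega
  have hcon : ∀ i, mem.getD (4 + d + 4 * V.length + i) 0 =
      (V.flatMap (content S W X T)).getD i 0 := by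
    intro i
    rw [hmem', List.getD_append_right _ _ _ _ (by simp; omega),
      List.getD_append_right _ _ _ _ (by simp; omega),
      List.getD_append_right _ _ _ _ (by simp; omega),
      List.getD_append_right _ _ _ _ (by rw [length_directory]; simp; omega)]
    congr 1; rw [length_directory]; simp; omega
  have hp2 : ∀ i (hi : i < V.length), mem.getD (4 + (positions W).length +
      (positions Wᶜ).length + 4 * i + 2) 0 =
      4 + d + 4 * V.length + ((V.take i).flatMap (content S W X T)).length := by
    intro i hi
    rw [add_assoc _ (4 * i), hdir _ (by omega), (directory_getD S W X T V _ i hi).2.2.1]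
  refine
    { lt_word := memory_lt_word S W X T hd hX hlen
      length_lt := hlen
      pow_le := le_trans (Nat.pow_le_pow_right (by norm_num) (by omega)) hd
      pow_le' := le_trans (Nat.pow_le_pow_right (by norm_num) (by omega)) hd
      numW := by rw [hmem', hP]; rfl
      numRest := by rw [hmem', hR]; rfl
      topLayer := by rw [hmem']; rfl
      numEntries := by rw [hmem']; rfl
      pos := fun j hj => ?_
      pos' := fun j hj => ?_
      directory_le := by omega
      vertex := fun i hi => ?_
      flag_one := fun i hi hb => ?_
      flag_zero := fun i hi hb => ?_
      content_length := fun i hi => ?_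
      content_le := fun i hi => ?_
      content := fun i hi j hj => ?_
      sorted := ?_
      vertex_lt := fun α hα => ?_ }
  · rw [hmem', List.getD_append_right _ _ _ _ (by simp),
      List.getD_append _ _ _ _ (by simp; omega), List.getD_eq_getElem _ _ (by simp; omega)]
    simp
  · rw [hmem', List.getD_append_right _ _ _ _ (by simp; omega),
      List.getD_append_right _ _ _ _ (by simp; omega),
      List.getD_append _ _ _ _ (by simp; omega), List.getD_eq_getElem _ _ (by simp; omega)]
    congr 1; simp; omega
  · rw [hdir _ (by omega), (directory_getD S W X T V _ i hi).1]
  · rw [add_assoc _ (4 * i), hdir _ (by omega), (directory_getD S W X T V _ i hi).2.1, if_pos hb]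
  · rw [add_assoc _ (4 * i), hdir _ (by omega), (directory_getD S W X T V _ i hi).2.1, if_neg hb]
  · rw [add_assoc _ (4 * i), hdir _ (by omega), (directory_getD S W X T V _ i hi).2.2.2]
  · have := length_flatMap_take_add_le (f := content S W X T) V i hi
    rw [hp2 i hi]; omega
  · rw [hp2 i hi, add_assoc (4 + d + 4 * V.length), hcon, flatMap_getD V i hi j hj]
  · exact List.Pairwise.filter _ List.pairwise_lt_range
  · rw [hP]; exact ((mem_storedVertices S W X).1 hα).1

theorem query_correct {w : ℕ} (hd : 2 ^ (d + 1) ≤ 2 ^ w) (hX : X < 2 ^ w)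
    (hlen : (topLevelsMemory S W X T).length < 2 ^ w) (v : Fin d → Bool) :
    ∃ M : ℕ, (M = 1 ∨ ∃ m, X < m ∧ m ≤ W.card ∧ M = 2 ^ (W.card - m)) ∧
      Runs w (topLevelsMemory S W X T) topLevelsQuery (initRegs v) (1000 * (d + 1) * (T + 1) * M)
        fun s' => s' .ans = truthValue (∃ i, OrthVec (S i) v) := by
  have hq : Nat.ofBits v < 2 ^ w := by
    have h1 := Nat.ofBits_lt_two_pow v
    rw [pow_succ] at hd; omega
  obtain ⟨M, hM, h⟩ := (layout S W X T hd hX hlen).runs_query (decides S W X T (Nat.ofBits v)) hq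
    (s := initRegs v) (by constructor <;> simp [initRegs])
  have hc : W.card + (Wᶜ).card = d := by
    rw [Finset.card_add_card_compl, Fintype.card_fin]
  rw [length_positions, length_positions, hc, truthValue_congr (answer_iff S W X T v)] at h
  rw [length_positions] at hM
  exact ⟨M, hM, h⟩

end

/-! ### Counting top vertices, long lists and memory cells -/

/-- For a given `u`, the equation `f u ^^^ α = m` has at most one solution `α`, so every vector is
counted at most once. -/
theorem sum_length_filter_xor_le (s : Finset ℕ) (f : ℕ → ℕ) (m : ℕ) (l : List ℕ) :
    ∑ α ∈ s, (l.filter fun u => f u ^^^ α = m).length ≤ l.length := by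
  induction l with
  | nil => simp
  | cons u l ih =>
    have h : ∀ α, ((u :: l).filter fun u => f u ^^^ α = m).length =
        (l.filter fun u => f u ^^^ α = m).length + if f u ^^^ α = m then 1 else 0 := by
      intro α
      rw [List.filter_cons]
      by_cases h : f u ^^^ α = m <;> simp [h]
    simp only [h, Finset.sum_add_distrib, List.length_cons]
    refine add_le_add ih ?_
    rw [← Finset.sum_filter, Finset.sum_const, smul_eq_mul, mul_one, Finset.card_le_one]
    intro α hα β hβ
    rw [Finset.mem_filter] at hα hβ
    exact Nat.xor_right_injective (hα.2.trans hβ.2.symm)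

theorem sum_range_pow_layer (K : ℕ) (y : ℝ) :
    ∑ α ∈ Finset.range (2 ^ K), y ^ layer K α = (1 + y) ^ K := by
  induction K with
  | zero => simp [layer]
  | succ K ih =>
    -- Split by the leading digit: it is `0` for `α` and `1` for `2 ^ K + α`, which yields the
    -- factors `1` and `y`.
    rw [pow_succ 2 K, mul_two, Finset.sum_range_add, pow_succ, mul_add, mul_one, ← ih,
      Finset.sum_mul]
    congr 1 <;> refine Finset.sum_congr rfl fun α hα => ?_
    · rw [layer_succ, Nat.testBit_lt_two_pow (Finset.mem_range.1 hα)]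
      simp
    · have h : layer K (2 ^ K + α) = layer K α := by
        unfold layer
        congr 1
        refine Finset.filter_congr fun j hj => ?_
        rw [Nat.testBit_two_pow_add_gt (Finset.mem_range.1 hj)]
      rw [layer_succ, Nat.testBit_two_pow_add_eq,
        Nat.testBit_lt_two_pow (Finset.mem_range.1 hα), h]
      simp [pow_succ]

/-- The number of the vertices in the top layers `0, …, X`. -/
def topCount (K X : ℕ) : ℕ := ((Finset.range (2 ^ K)).filter fun α => layer K α ≤ X).card

theorem topCount_le (K X : ℕ) : topCount K X ≤ 2 ^ K :=
  (Finset.card_filter_le _ _).trans_eq (Finset.card_range _)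

/-- The Chernoff argument: as `y ≤ 1`, every top vertex contributes at least `y ^ X` to the
generating function. -/
theorem topCount_mul_pow_le (K X : ℕ) {y : ℝ} (hy : 0 < y) (hy1 : y ≤ 1) :
    topCount K X * y ^ X ≤ (1 + y) ^ K := by
  rw [← sum_range_pow_layer, topCount, ← nsmul_eq_mul]
  refine (Finset.card_nsmul_le_sum _ _ _ fun α hα => ?_).trans
    (Finset.sum_le_sum_of_subset_of_nonneg (Finset.filter_subset _ _) fun _ _ _ => by positivity)
  exact pow_le_pow_of_le_one hy.le hy1 (Finset.mem_filter.1 hα).2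

section

variable {d n : ℕ} (S : Fin n → Fin d → Bool) (W : Finset (Fin d)) (X T : ℕ)

theorem sum_length_vertexList_le :
    ∑ α ∈ Finset.range (2 ^ W.card), (vertexList S W α).length ≤ n :=
  (sum_length_filter_xor_le _ _ _ _).trans_eq (by simp [inputCodes])

/-- The number of the vertices with more than `T` input vectors. -/
def longCount : ℕ :=
  ((Finset.range (2 ^ W.card)).filter fun α => T < (vertexList S W α).length).card

theorem longCount_mul_le : longCount S W T * (T + 1) ≤ n := by
  rw [longCount, ← smul_eq_mul]
  refine (Finset.card_nsmul_le_sum _ (fun α => (vertexList S W α).length) _ fun α hα => ?_).trans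
    ((Finset.sum_le_sum_of_subset (Finset.filter_subset _ _)).trans
      (sum_length_vertexList_le S W))
  exact (Finset.mem_filter.1 hα).2

theorem nodup_storedVertices : (storedVertices S W X).Nodup :=
  List.Nodup.filter _ List.nodup_range

theorem length_storedVertices_le : (storedVertices S W X).length ≤ topCount W.card X + n := by
  rw [← List.toFinset_card_of_nodup (nodup_storedVertices S W X)]
  have h : (storedVertices S W X).toFinset ⊆
      ((Finset.range (2 ^ W.card)).filter fun α => layer W.card α ≤ X) ∪
      (Finset.range (2 ^ W.card)).filter fun α => 0 < (vertexList S W α).length := by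
    intro α hα
    rw [List.mem_toFinset, mem_storedVertices] at hα
    simp only [Finset.mem_union, Finset.mem_filter, Finset.mem_range, List.length_pos_iff]
    tauto
  refine ((Finset.card_le_card h).trans (Finset.card_union_le _ _)).trans
    (Nat.add_le_add_left ?_ _)
  -- With threshold `0` the long lists are the nonempty ones.
  simpa [longCount] using longCount_mul_le S W 0

theorem length_content_le (α : ℕ) : (content S W X T α).length ≤
    (if layer W.card α ≤ X then 2 ^ (Wᶜ).card else 0) +
      (if T < (vertexList S W α).length then 2 ^ (Wᶜ).card else 0) +
      (vertexList S W α).length := by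
  by_cases h1 : layer W.card α ≤ X
  · rw [content_of_top S W X T h1, length_bitmap, if_pos h1]; omega
  · by_cases h2 : T < (vertexList S W α).length
    · rw [content_of_long S W X T h1 h2, length_bitmap, if_pos h2]; omega
    · rw [content_of_short S W X T h1 h2]; omega

theorem length_contents_le : ((storedVertices S W X).flatMap (content S W X T)).length ≤
    (topCount W.card X + longCount S W T) * 2 ^ (Wᶜ).card + n := by
  rw [List.length_flatMap, ← List.sum_toFinset _ (nodup_storedVertices S W X)]
  have h : (storedVertices S W X).toFinset ⊆ Finset.range (2 ^ W.card) := by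
    intro α hα
    rw [List.mem_toFinset, mem_storedVertices] at hα
    exact Finset.mem_range.2 hα.1
  refine (Finset.sum_le_sum_of_subset h).trans
    ((Finset.sum_le_sum fun α _ => length_content_le S W X T α).trans ?_)
  rw [Finset.sum_add_distrib, Finset.sum_add_distrib, ← Finset.sum_filter, ← Finset.sum_filter,
    Finset.sum_const, Finset.sum_const, smul_eq_mul, smul_eq_mul, ← add_mul]
  exact Nat.add_le_add_left (sum_length_vertexList_le S W) _

theorem length_memory_le : (topLevelsMemory S W X T).length ≤
    4 + d + 4 * (topCount W.card X + n) +
      ((topCount W.card X + longCount S W T) * 2 ^ (Wᶜ).card + n) := by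
  rw [length_topLevelsMemory]
  have h1 := length_storedVertices_le S W X
  have h2 := length_contents_le S W X T
  omega

/-- A crude bound, uniform in `W`, `X` and `T`: it makes all addresses fit into words whose length
depends only on `c` and `n`. -/
theorem length_memory_lt (hn : 2 ≤ n) : (topLevelsMemory S W X T).length < 2 ^ (d + 4) * n := by
  have hc : W.card + (Wᶜ).card = d := by
    rw [Finset.card_add_card_compl, Fintype.card_fin]
  have h1 := length_memory_le S W X T
  have h2 := topCount_le W.card X
  have h3 : longCount S W T ≤ n :=
    (Nat.le_mul_of_pos_right _ (by omega)).trans (longCount_mul_le S W T)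
  have h4 : 2 ^ W.card * 2 ^ (Wᶜ).card = 2 ^ d := by rw [← pow_add, hc]
  have h5 : d < 2 ^ d := Nat.lt_two_pow_self
  have h6 : 1 ≤ 2 ^ W.card := Nat.one_le_two_pow
  have h7 : 1 ≤ 2 ^ (Wᶜ).card := Nat.one_le_two_pow
  have h8 : 2 ^ W.card ≤ 2 ^ d := Nat.pow_le_pow_right (by norm_num) (by omega)
  have h9 : 2 ^ (Wᶜ).card ≤ 2 ^ d := Nat.pow_le_pow_right (by norm_num) (by omega)
  have h10 : (topCount W.card X + longCount S W T) * 2 ^ (Wᶜ).card ≤ 2 ^ d + n * 2 ^ d := by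
    rw [add_mul]
    exact add_le_add ((Nat.mul_le_mul_right _ h2).trans_eq h4) (Nat.mul_le_mul h3 h9)
  rw [pow_add]
  nlinarith

end

/-! ### From rounded logarithms to powers of `n` -/

section

variable {n : ℕ}

theorem one_le_logb (hn : 2 ≤ n) : 1 ≤ Real.logb 2 n := by
  rw [Real.le_logb_iff_rpow_le (by norm_num) (by positivity), Real.rpow_one]
  exact_mod_cast hn

theorem logb_natCast_nonneg (n : ℕ) : 0 ≤ Real.logb 2 n := by
  rcases Nat.eq_zero_or_pos n with rfl | h
  · simp
  · exact Real.logb_nonneg (by norm_num) (by exact_mod_cast h)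

theorem rpow_eq_two_rpow (hn : 2 ≤ n) (y : ℝ) : (n : ℝ) ^ y = 2 ^ (Real.logb 2 n * y) := by
  rw [Real.rpow_mul (by norm_num), Real.rpow_logb (by norm_num) (by norm_num) (by positivity)]

theorem logb_le_clog (hn : 2 ≤ n) : Real.logb 2 n ≤ Nat.clog 2 n := by
  rw [Real.logb_le_iff_le_rpow (by norm_num) (by positivity), Real.rpow_natCast]
  exact_mod_cast Nat.le_pow_clog (by norm_num) n

theorem clog_le_logb (hn : 2 ≤ n) : (Nat.clog 2 n : ℝ) ≤ Real.logb 2 n + 1 := by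
  have h := Nat.pow_pred_clog_lt_self (b := 2) (by norm_num) (show 1 < n by omega)
  have h' : ((2 : ℝ) ^ ((Nat.clog 2 n).pred : ℝ)) ≤ n := by
    rw [Real.rpow_natCast]; exact_mod_cast h.le
  rw [← Real.le_logb_iff_rpow_le (by norm_num) (by positivity)] at h'
  have h2 : 0 < Nat.clog 2 n := Nat.clog_pos (by norm_num) hn
  rw [Nat.pred_eq_sub_one, Nat.cast_sub h2] at h'
  push_cast at h'
  linarith

theorem logb_le_rpow {ε : ℝ} (hε : 0 < ε) : Real.logb 2 n ≤ 2 / ε * (n : ℝ) ^ ε := by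
  have h1 := Real.log_le_rpow_div (Nat.cast_nonneg n) hε
  have h2 : (1 : ℝ) / 2 < Real.log 2 := by linarith [Real.log_two_gt_d9]
  have h3 : 0 ≤ (n : ℝ) ^ ε / ε := by positivity
  rw [Real.logb, div_le_iff₀ (by linarith)]
  calc _ ≤ (n : ℝ) ^ ε / ε := h1
    _ = 2 / ε * (n : ℝ) ^ ε * (1 / 2) := by field_simp
    _ ≤ _ := by
      refine mul_le_mul_of_nonneg_left h2.le ?_
      positivity

variable {c k x : ℝ}

theorem logMul_mono (h : k ≤ c) : logMul k n ≤ logMul c n :=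
  Nat.floor_mono (mul_le_mul_of_nonneg_right h (logb_natCast_nonneg n))

theorem logMul_le (hc : 0 ≤ c) : (logMul c n : ℝ) ≤ c * Real.logb 2 n :=
  Nat.floor_le (mul_nonneg hc (logb_natCast_nonneg n))

theorem lt_logMul_add_one : c * Real.logb 2 n < logMul c n + 1 := Nat.lt_floor_add_one _

/-- The factor `2` pays for rounding `k log n` down. -/
theorem two_pow_logMul_sub_le (hn : 2 ≤ n) (hc : 0 ≤ c) (hkc : k ≤ c) :
    (2 : ℝ) ^ (logMul c n - logMul k n) ≤ 2 * (n : ℝ) ^ (c - k) := by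
  rw [rpow_eq_two_rpow hn, ← Real.rpow_natCast, Nat.cast_sub (logMul_mono hkc)]
  have h1 := logMul_le (n := n) hc
  have h2 := lt_logMul_add_one (n := n) (c := k)
  calc _ ≤ (2 : ℝ) ^ (1 + Real.logb 2 n * (c - k)) :=
        Real.rpow_le_rpow_of_exponent_le (by norm_num) (by linarith)
    _ = _ := by rw [Real.rpow_add (by norm_num), Real.rpow_one]

/-- Here rounding is free: an integer above the floor of `x log n` exceeds `x log n` itself. -/
theorem two_pow_logMul_sub_le_of_lt (hn : 2 ≤ n) (hk : 0 ≤ k) {m : ℕ} (hm : logMul x n < m)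
    (hmk : m ≤ logMul k n) : (2 : ℝ) ^ (logMul k n - m) ≤ (n : ℝ) ^ (k - x) := by
  rw [rpow_eq_two_rpow hn, ← Real.rpow_natCast, Nat.cast_sub hmk]
  have h1 := logMul_le (n := n) hk
  have h2 := lt_logMul_add_one (n := n) (c := x)
  have h3 : (logMul x n + 1 : ℝ) ≤ m := by exact_mod_cast hm
  exact Real.rpow_le_rpow_of_exponent_le (by norm_num) (by linarith)

/-- The estimate of the sum of the binomial coefficients up to `x log n` by the entropy. -/
theorem topCount_logMul_le (hn : 2 ≤ n) (hx : 0 < x) (hxk : x ≤ k / 2) :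
    (topCount (logMul k n) (logMul x n) : ℝ) ≤ (n : ℝ) ^ binomExponent k x := by
  set ℓ := Real.logb 2 n with hℓ
  have hkx : 0 < k - x := by linarith
  have hk : 0 < k := by linarith
  -- This `y` minimizes `(1 + y) ^ k / y ^ x`; the assumption `x ≤ k / 2` is what makes it at most
  -- `1`.
  set y := x / (k - x) with hy
  have hy0 : 0 < y := by positivity
  have hy1 : y ≤ 1 := by rw [hy, div_le_one hkx]; linarith
  have e1 : 1 + y = 2 ^ (Real.logb 2 k - Real.logb 2 (k - x)) := by
    rw [← Real.logb_div hk.ne' hkx.ne', Real.rpow_logb (by norm_num) (by norm_num) (by positivity),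
      hy]
    field_simp; ring
  have e2 : y = 2 ^ (Real.logb 2 x - Real.logb 2 (k - x)) := by
    rw [← Real.logb_div hx.ne' hkx.ne', Real.rpow_logb (by norm_num) (by norm_num) (by positivity)]
  have h1 := topCount_mul_pow_le (logMul k n) (logMul x n) hy0 hy1
  have h2 : y ^ (x * ℓ) ≤ y ^ logMul x n := by
    rw [← Real.rpow_natCast]
    exact Real.rpow_le_rpow_of_exponent_ge hy0 hy1 (logMul_le hx.le)
  have h3 : (1 + y) ^ logMul k n ≤ (1 + y) ^ (k * ℓ) := by
    rw [← Real.rpow_natCast]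
    exact Real.rpow_le_rpow_of_exponent_le (by linarith) (logMul_le hk.le)
  have h4 : (topCount (logMul k n) (logMul x n) : ℝ) * y ^ (x * ℓ) ≤ (1 + y) ^ (k * ℓ) :=
    (mul_le_mul_of_nonneg_left h2 (Nat.cast_nonneg _)).trans (h1.trans h3)
  rw [← le_div_iff₀ (by positivity)] at h4
  refine h4.trans_eq ?_
  rw [rpow_eq_two_rpow hn]
  conv_lhs => rw [e1, e2]
  rw [← Real.rpow_mul (by norm_num), ← Real.rpow_mul (by norm_num), ← Real.rpow_sub (by norm_num),
    binomExponent]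
  congr 1; ring

end

/-! ### Asymptotic time and space bounds -/

theorem TopLevelsSolvesOV.mono {c k x τ : ℝ} {b : ℕ} {time space time' space' : ℕ → ℝ}
    (h : TopLevelsSolvesOV c k x τ b time space) (ht : ∀ n, 2 ≤ n → time n ≤ time' n)
    (hs : ∀ n, 2 ≤ n → space n ≤ space' n) : TopLevelsSolvesOV c k x τ b time' space' := by
  intro n hn S W hW
  obtain ⟨h1, h2, h3⟩ := h n hn S W hW
  refine ⟨h1, h2.trans (hs n hn), fun v => ?_⟩
  obtain ⟨s, t, hx, htt, ha⟩ := h3 v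
  exact ⟨s, t, hx, htt.trans (ht n hn), ha⟩

section

variable {c k x δ : ℝ} {n : ℕ}

/-- Of the `⌈c⌉₊ + 5` blocks of `⌈log n⌉` bits, `⌈c⌉₊` cover the dimension, four the summand `4`,
and one the factor `n` in the memory length. -/
theorem wordLength_ge (hn : 2 ≤ n) (hc : 0 ≤ c) :
    logMul c n + 4 + Nat.clog 2 n ≤ wordLength (⌈c⌉₊ + 5) n := by
  have hL : 1 ≤ Nat.clog 2 n := Nat.clog_pos (by norm_num) hn
  have h1 : logMul c n ≤ ⌈c⌉₊ * Nat.clog 2 n := by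
    have : (logMul c n : ℝ) ≤ (⌈c⌉₊ : ℝ) * Nat.clog 2 n :=
      (logMul_le hc).trans (mul_le_mul (Nat.le_ceil c) (logb_le_clog hn)
        (logb_natCast_nonneg n) (Nat.cast_nonneg _))
    exact_mod_cast this
  unfold wordLength
  nlinarith

theorem length_memory_lt_word (hn : 2 ≤ n) (hc : 0 ≤ c) (S : Fin n → Fin (logMul c n) → Bool)
    (W : Finset (Fin (logMul c n))) (X T : ℕ) :
    (topLevelsMemory S W X T).length < 2 ^ wordLength (⌈c⌉₊ + 5) n :=
  calc _ < 2 ^ (logMul c n + 4) * n := length_memory_lt S W X T hn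
    _ ≤ 2 ^ (logMul c n + 4) * 2 ^ Nat.clog 2 n :=
      Nat.mul_le_mul_left _ (Nat.le_pow_clog (by norm_num) n)
    _ ≤ _ := by
      rw [← pow_add]
      exact Nat.pow_le_pow_right (by norm_num) (wordLength_ge hn hc)

theorem length_memory_le_rpow (hn : 2 ≤ n) (hx : 0 < x) (hxk : x ≤ k / 2) (hkc : k ≤ c)
    (S : Fin n → Fin (logMul c n) → Bool) (W : Finset (Fin (logMul c n)))
    (hW : W.card = logMul k n) :
    ((topLevelsMemory S W (logMul x n) ⌊(n : ℝ) ^ (1 - k + x - δ)⌋₊).length : ℝ) ≤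
      (9 + c) * ((n : ℝ) ^ (c - k + binomExponent k x) + (n : ℝ) ^ (c - x + δ) + n) := by
  have hn0 : (0 : ℝ) < n := by positivity
  have hn2 : (2 : ℝ) ≤ n := by exact_mod_cast hn
  have hc : 0 < c := by linarith
  set T := ⌊(n : ℝ) ^ (1 - k + x - δ)⌋₊ with hT
  have hR : (Wᶜ).card = logMul c n - logMul k n := by
    rw [Finset.card_compl, Fintype.card_fin, hW]
  have h1 : ((topLevelsMemory S W (logMul x n) T).length : ℝ) ≤
      4 + logMul c n + 4 * (topCount (logMul k n) (logMul x n) + n) +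
      ((topCount (logMul k n) (logMul x n) + longCount S W T) *
        2 ^ (logMul c n - logMul k n) + n) := by
    have := length_memory_le S W (logMul x n) T
    rw [hR, hW] at this
    exact_mod_cast this
  have h2 := two_pow_logMul_sub_le hn hc.le hkc
  have h3 := topCount_logMul_le hn hx hxk
  -- The directory entries of the top vertices cost no more than their bitmaps, since `k ≤ c`.
  have h4 : (n : ℝ) ^ binomExponent k x ≤ (n : ℝ) ^ (c - k + binomExponent k x) :=
    Real.rpow_le_rpow_of_exponent_le (by linarith) (by linarith)
  have h5 : (topCount (logMul k n) (logMul x n) : ℝ) * 2 ^ (logMul c n - logMul k n) ≤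
      2 * (n : ℝ) ^ (c - k + binomExponent k x) := by
    refine (mul_le_mul h3 h2 (by positivity) (by positivity)).trans_eq ?_
    rw [Real.rpow_add hn0 (c - k)]; ring
  have h6 : (longCount S W T : ℝ) ≤ (n : ℝ) ^ (k - x + δ) := by
    have h := longCount_mul_le S W T
    have h' : (longCount S W T : ℝ) * (T + 1) ≤ n := by exact_mod_cast h
    have h'' : (longCount S W T : ℝ) * (n : ℝ) ^ (1 - k + x - δ) ≤ n :=
      (mul_le_mul_of_nonneg_left (Nat.lt_floor_add_one _).le (Nat.cast_nonneg _)).trans h'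
    rw [← le_div_iff₀ (by positivity)] at h''
    refine h''.trans_eq ?_
    nth_rewrite 1 [← Real.rpow_one (n : ℝ)]
    rw [← Real.rpow_sub hn0]
    congr 1; ring
  have h7 : (longCount S W T : ℝ) * 2 ^ (logMul c n - logMul k n) ≤
      2 * (n : ℝ) ^ (c - x + δ) := by
    refine (mul_le_mul h6 h2 (by positivity) (by positivity)).trans_eq ?_
    rw [show c - x + δ = (k - x + δ) + (c - k) by ring, Real.rpow_add hn0 (k - x + δ)]; ring
  have h8 : (logMul c n : ℝ) ≤ c * n := by
    refine (logMul_le hc.le).trans (mul_le_mul_of_nonneg_left ?_ hc.le)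
    rw [Real.logb_le_iff_le_rpow (by norm_num) hn0, Real.rpow_natCast]
    exact_mod_cast Nat.lt_two_pow_self.le
  have h9 : 0 ≤ c * ((n : ℝ) ^ (c - k + binomExponent k x) + (n : ℝ) ^ (c - x + δ)) := by positivity
  have h10 : 0 ≤ (n : ℝ) ^ (c - x + δ) := by positivity
  nlinarith

theorem time_le_rpow (hn : 2 ≤ n) (hx : 0 < x) (hxk : x ≤ k / 2) (hkc : k ≤ c)
    (hδ1 : δ ≤ 1 - k + x) {M : ℕ}
    (hM : M = 1 ∨ ∃ m, logMul x n < m ∧ m ≤ logMul k n ∧ M = 2 ^ (logMul k n - m)) :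
    ((1000 * (logMul c n + 1) * (⌊(n : ℝ) ^ (1 - k + x - δ)⌋₊ + 1) * M : ℕ) : ℝ) ≤
      2000 * (c + 1) * Real.logb 2 n * (n : ℝ) ^ (1 - δ) := by
  have hn0 : (0 : ℝ) < n := by positivity
  have hn1 : (1 : ℝ) ≤ n := by exact_mod_cast (by omega : 1 ≤ n)
  have hℓ := one_le_logb hn
  have h1 : (M : ℝ) ≤ (n : ℝ) ^ (k - x) := by
    rcases hM with rfl | ⟨m, hm, hmk, rfl⟩
    · exact_mod_cast Real.one_le_rpow hn1 (by linarith)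
    · exact_mod_cast two_pow_logMul_sub_le_of_lt hn (by linarith) hm hmk
  have h2 : (⌊(n : ℝ) ^ (1 - k + x - δ)⌋₊ : ℝ) + 1 ≤ 2 * (n : ℝ) ^ (1 - k + x - δ) := by
    have := Nat.floor_le (show 0 ≤ (n : ℝ) ^ (1 - k + x - δ) by positivity)
    have := Real.one_le_rpow hn1 (show 0 ≤ 1 - k + x - δ by linarith)
    linarith
  have h3 : (logMul c n : ℝ) + 1 ≤ (c + 1) * Real.logb 2 n := by
    have := logMul_le (n := n) (show 0 ≤ c by linarith)
    linarith
  have e : (n : ℝ) ^ (1 - δ) = (n : ℝ) ^ (1 - k + x - δ) * (n : ℝ) ^ (k - x) := by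
    rw [← Real.rpow_add hn0]; congr 1; ring
  push_cast
  calc 1000 * ((logMul c n : ℝ) + 1) * (⌊(n : ℝ) ^ (1 - k + x - δ)⌋₊ + 1) * M
      ≤ 1000 * ((c + 1) * Real.logb 2 n) * (2 * (n : ℝ) ^ (1 - k + x - δ)) * (n : ℝ) ^ (k - x) := by
        have : 0 ≤ c + 1 := by linarith
        gcongr
    _ = _ := by rw [e]; ring

theorem topLevelsSolvesOV (hx : 0 < x) (hxk : x ≤ k / 2) (hkc : k ≤ c)
    (hδ1 : δ ≤ 1 - k + x) {ε : ℝ} (hε : 0 < ε) :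
    ∃ C : ℝ, TopLevelsSolvesOV c k x (1 - k + x - δ) (⌈c⌉₊ + 5)
      (fun n => C * (n : ℝ) ^ ε * (n : ℝ) ^ (1 - δ))
      (fun n => C * (n : ℝ) ^ ε *
        ((n : ℝ) ^ (c - k + binomExponent k x) + (n : ℝ) ^ (c - x + δ) + n)) := by
  have hc : 0 < c := by linarith
  set B := ⌈c⌉₊ + 5 with hB
  -- The sum of the constants for time and for space; `2 / ε` comes from `logb_le_rpow`, and the
  -- further `2` from `⌈log n⌉ ≤ 2 log n`.
  refine ⟨2000 * (c + 1) * (2 / ε) + (9 + c) * (B * (2 * (2 / ε))), fun n hn S W hW => ?_⟩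
  have hn0 : (0 : ℝ) < n := by positivity
  have hw := wordLength_ge hn hc.le
  rw [← hB] at hw
  have hlen := length_memory_lt_word hn hc.le S W (logMul x n) ⌊(n : ℝ) ^ (1 - k + x - δ)⌋₊
  rw [← hB] at hlen
  have hd : 2 ^ (logMul c n + 1) ≤ 2 ^ wordLength B n :=
    Nat.pow_le_pow_right (by norm_num) (by omega)
  have hX : logMul x n < 2 ^ wordLength B n := by
    have h1 : logMul x n ≤ logMul c n := logMul_mono (by linarith)
    have h2 : wordLength B n < 2 ^ wordLength B n := Nat.lt_two_pow_self
    omega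
  have hℓ := logb_le_rpow (n := n) hε
  refine ⟨memory_lt_word S W _ _ hd hX hlen, ?_, fun v => ?_⟩
  · beta_reduce
    have h1 := length_memory_le_rpow (δ := δ) hn hx hxk hkc S W hW
    have h2 : (wordLength B n : ℝ) ≤ B * (2 * (2 / ε)) * (n : ℝ) ^ ε := by
      have h3 := clog_le_logb hn
      have h4 := one_le_logb hn
      rw [wordLength, Nat.cast_mul, mul_assoc]
      refine mul_le_mul_of_nonneg_left ?_ (Nat.cast_nonneg _)
      linarith
    set E := (n : ℝ) ^ (c - k + binomExponent k x) + (n : ℝ) ^ (c - x + δ) + n with hE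
    have hE0 : 0 ≤ E := by positivity
    calc _ ≤ (9 + c) * E * (B * (2 * (2 / ε)) * (n : ℝ) ^ ε) :=
          mul_le_mul h1 h2 (Nat.cast_nonneg _) (by positivity)
      _ = (9 + c) * (B * (2 * (2 / ε))) * (n : ℝ) ^ ε * E := by ring
      _ ≤ _ := by
        gcongr
        have : 0 ≤ 2000 * (c + 1) * (2 / ε) := by positivity
        linarith
  · obtain ⟨M, hM, s, t, hx', ht, hs⟩ := query_correct S W (logMul x n)
      ⌊(n : ℝ) ^ (1 - k + x - δ)⌋₊ hd hX hlen v
    rw [hW] at hM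
    refine ⟨s, t, hx', ?_, hs.trans (by unfold truthValue; congr)⟩
    beta_reduce
    calc (t : ℝ) ≤ _ := (Nat.cast_le.2 ht).trans (time_le_rpow hn hx hxk hkc hδ1 hM)
      _ ≤ 2000 * (c + 1) * (2 / ε * (n : ℝ) ^ ε) * (n : ℝ) ^ (1 - δ) := by gcongr
      _ = 2000 * (c + 1) * (2 / ε) * (n : ℝ) ^ ε * (n : ℝ) ^ (1 - δ) := by ring
      _ ≤ _ := by
        gcongr
        have : 0 ≤ (9 + c) * (B * (2 * (2 / ε))) := by positivity
        linarith

end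

/-! ### The threshold `γ` and the sublinear regime -/

theorem continuousAt_binomExponent_one_add {g : ℝ} (hg : 0 < g) :
    ContinuousAt (fun g => binomExponent (1 + g) g) g := by
  have h1 : 1 + g ≠ 0 := by positivity
  have h2 : 1 + g - g ≠ 0 := by simp
  unfold binomExponent Real.logb
  fun_prop (disch := first | assumption | positivity)

theorem continuousAt_binomExponent_left {k x : ℝ} (hk : k ≠ 0) (hkx : k - x ≠ 0) :
    ContinuousAt (fun k => binomExponent k x) k := by
  unfold binomExponent Real.logb
  fun_prop (disch := first | assumption | positivity)

theorem binomExponent_one_add (g : ℝ) : binomExponent (1 + g) g =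
    ((1 + g) * Real.log (1 + g) - g * Real.log g) / Real.log 2 := by
  rw [binomExponent, add_sub_cancel_right]
  simp only [Real.logb, Real.log_one]
  ring

theorem binomExponent_lt_one : binomExponent (1 + 0.29) 0.29 < 1 := by
  rw [binomExponent_one_add, div_lt_one (Real.log_pos (by norm_num))]
  -- Multiplied by `100` and exponentiated, the claim compares rational numbers; likewise with `10`
  -- at `0.3`.
  have h : (129 : ℝ) * Real.log (1 + 0.29) < 100 * Real.log 2 + 29 * Real.log 0.29 := by
    have := Real.log_lt_log (x := (1 + 0.29 : ℝ) ^ 129) (y := 2 ^ 100 * 0.29 ^ 29)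
      (by positivity) (by norm_num)
    rw [Real.log_mul (by positivity) (by positivity), Real.log_pow, Real.log_pow, Real.log_pow]
      at this
    exact_mod_cast this
  linarith

theorem one_lt_binomExponent : 1 < binomExponent (1 + 0.3) 0.3 := by
  rw [binomExponent_one_add, one_lt_div (Real.log_pos (by norm_num))]
  have h : 10 * Real.log 2 + 3 * Real.log 0.3 < 13 * Real.log (1 + 0.3) := by
    have := Real.log_lt_log (y := (1 + 0.3 : ℝ) ^ 13) (x := 2 ^ 10 * 0.3 ^ 3)
      (by positivity) (by norm_num)
    rw [Real.log_mul (by positivity) (by positivity), Real.log_pow, Real.log_pow, Real.log_pow]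
      at this
    exact_mod_cast this
  linarith

theorem exists_binomExponent_eq_one :
    ∃ γ : ℝ, 0.29 < γ ∧ γ < 0.3 ∧ binomExponent (1 + γ) γ = 1 := by
  have h := intermediate_value_Ioo (show (0.29 : ℝ) ≤ 0.3 by norm_num)
    (f := fun g => binomExponent (1 + g) g) (fun g hg =>
      (continuousAt_binomExponent_one_add (lt_of_lt_of_le (by norm_num) hg.1)).continuousWithinAt)
  obtain ⟨γ, hγ, h1⟩ := h ⟨binomExponent_lt_one, one_lt_binomExponent⟩
  exact ⟨γ, hγ.1, hγ.2, h1⟩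

theorem exists_sublinear_parameters {γ c : ℝ} (h29 : 0.29 < γ) (h3 : γ < 0.3)
    (hγ : binomExponent (1 + γ) γ = 1) (hc : 1 + γ ≤ c) {ε : ℝ} (hε : 0 < ε) :
    ∃ k x τ : ℝ, |k - (1 + γ)| < ε ∧ |x - γ| < ε ∧
      0 < x ∧ x ≤ k / 2 ∧ k ≤ c ∧ k - x < 1 ∧ 0 ≤ τ ∧ τ < 1 - k + x ∧
      ∃ C η : ℝ, 0 < η ∧ TopLevelsSolvesOV c k x τ (⌈c⌉₊ + 5)
        (fun n => C * (n : ℝ) ^ (1 - η)) (fun n => C * (n : ℝ) ^ (c - γ + ε)) := by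
  have hcont : ContinuousAt (fun k => c - k + binomExponent k γ) (1 + γ) :=
    (continuousAt_const.sub continuousAt_id).add
      (continuousAt_binomExponent_left (by linarith) (by simp))
  obtain ⟨ρ, hρ, hball⟩ := Metric.continuousAt_iff.1 hcont (ε / 2) (by positivity)
  -- `k = 1 + γ - μ` leaves the gap `1 - k + x = μ`. Half of it goes to `δ` and half to `τ`; the `ε`
  -- of the first part is `μ / 4`, so the time exponent is `1 - μ / 4`.
  obtain ⟨μ, hμ0, hμ⟩ : ∃ μ : ℝ, 0 < μ ∧ μ < min (min ρ ε) (1 / 2) := exists_between (by positivity)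
  rw [lt_min_iff, lt_min_iff] at hμ
  obtain ⟨⟨hμρ, hμε⟩, hμ2⟩ := hμ
  have hk := hball (x := 1 + γ - μ) (by rw [Real.dist_eq, abs_lt]; constructor <;> linarith)
  rw [Real.dist_eq, hγ] at hk
  have hk := (abs_lt.1 hk).2
  obtain ⟨C, hC⟩ := topLevelsSolvesOV (c := c) (k := 1 + γ - μ) (x := γ) (δ := μ / 2)
    (by linarith) (by linarith) (by linarith) (by linarith) (ε := μ / 4) (by positivity)
  refine ⟨1 + γ - μ, γ, 1 - (1 + γ - μ) + γ - μ / 2, by rw [abs_lt]; constructor <;> linarith,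
    by simpa using hε, by linarith, by linarith, by linarith, by linarith, by linarith, by linarith,
    3 * |C|, μ / 4, by positivity, hC.mono (fun n hn => ?_) fun n hn => ?_⟩
  all_goals
    have hn0 : (0 : ℝ) < n := by positivity
    have hn1 : (1 : ℝ) ≤ n := by exact_mod_cast (by omega : 1 ≤ n)
    have hCn := abs_nonneg C
  · rw [mul_assoc, ← Real.rpow_add hn0, show μ / 4 + (1 - μ / 2) = 1 - μ / 4 by ring]
    refine mul_le_mul_of_nonneg_right ?_ (by positivity)
    linarith [le_abs_self C]
  · have hexp : ∀ y, μ / 4 + y ≤ c - γ + ε →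
        (n : ℝ) ^ (μ / 4) * (n : ℝ) ^ y ≤ (n : ℝ) ^ (c - γ + ε) := by
      intro y hy
      rw [← Real.rpow_add hn0]
      exact Real.rpow_le_rpow_of_exponent_le hn1 hy
    have h1 := hexp (c - (1 + γ - μ) + binomExponent (1 + γ - μ) γ) (by linarith)
    have h2 := hexp (c - γ + μ / 2) (by linarith)
    -- The linear term is dominated because `c ≥ 1 + γ`.
    have h4 := hexp 1 (by linarith)
    rw [Real.rpow_one] at h4
    calc _ ≤ |C| * (n : ℝ) ^ (μ / 4) * ((n : ℝ) ^ (c - (1 + γ - μ) + binomExponent (1 + γ - μ) γ) +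
          (n : ℝ) ^ (c - γ + μ / 2) + n) := by
          gcongr; exact le_abs_self C
      _ ≤ |C| * (3 * (n : ℝ) ^ (c - γ + ε)) := by
          rw [mul_assoc]
          refine mul_le_mul_of_nonneg_left ?_ hCn
          linarith
      _ = _ := by ring

theorem mainTheorem2 :
    (∀ c : ℝ, ∃ b : ℕ, ∀ k x δ : ℝ, 0 < x → x ≤ k / 2 → k ≤ c → 0 < δ → δ ≤ 1 - k + x →
      ∀ ε : ℝ, 0 < ε → ∃ C : ℝ,
        TopLevelsSolvesOV c k x (1 - k + x - δ) b
          (fun n => C * (n : ℝ) ^ ε * (n : ℝ) ^ (1 - δ))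
          (fun n => C * (n : ℝ) ^ ε *
            ((n : ℝ) ^ (c - k + binomExponent k x) + (n : ℝ) ^ (c - x + δ) + n))) ∧
    ∃ γ : ℝ, 0.29 < γ ∧ γ < 0.3 ∧ binomExponent (1 + γ) γ = 1 ∧
      ∀ c : ℝ, 1 + γ ≤ c → ∃ b : ℕ, ∀ ε : ℝ, 0 < ε →
        ∃ k x τ : ℝ, |k - (1 + γ)| < ε ∧ |x - γ| < ε ∧
          0 < x ∧ x ≤ k / 2 ∧ k ≤ c ∧ k - x < 1 ∧ 0 ≤ τ ∧ τ < 1 - k + x ∧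
          ∃ C η : ℝ, 0 < η ∧
            TopLevelsSolvesOV c k x τ b
              (fun n => C * (n : ℝ) ^ (1 - η))
              (fun n => C * (n : ℝ) ^ (c - γ + ε)) := by
  refine ⟨fun c => ⟨⌈c⌉₊ + 5, fun k x δ hx hxk hkc _ hδ ε hε =>
    topLevelsSolvesOV hx hxk hkc hδ hε⟩, ?_⟩
  obtain ⟨γ, h1, h2, h3⟩ := exists_binomExponent_eq_one
  exact ⟨γ, h1, h2, h3, fun c hc => ⟨⌈c⌉₊ + 5, fun ε hε =>
    exists_sublinear_parameters h1 h2 h3 hc hε⟩⟩
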